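/- Let $\mathbb G$ be a stratified (Carnot) group, identified through exponential coordinates with its stratified Lie algebra $\mathbb G=V_1\oplus\cdots\oplus V_\iota$, $[V_1,V_j]=V_{j+1}$ for $j\ge 1$ (with $V_j=\{0\}$ for $j>\iota\ge1$, $V_\iota\neq\{0\}$), with the group operation given by the Baker–Campbell–Hausdorff formula. Equip it with a scalar product making a graded basis orthonormal, the dilations $\delta_r$ ($\delta_r=r^i$ on $V_i$), a Haar measure $\mu$, and a homogeneous distance $d$, i.e. a continuous left-invariant distance with $d(\delta_r x,\delta_r y)=r\,d(x,y)$ for $r>0$. Let $Q=\sum_i i\dim V_i$ be the homogeneous dimension, and let $X_1,\dots,X_m$ be the left-invariant vector fields associated with an orthonormal basis of $V_1$; put $\nabla_H\phi=\sum_j (X_j\phi)X_j$. For $\alpha\ge 0$ let $$\mathcal S^\alpha(A)=\sup_{\delta>0}\ \inf\Big\{\sum_{j} r_j^\alpha:\ 2r_j<\delta,\ A\subset\bigcup_{j} B(x_j,r_j)\Big\}$$ be the spherical measure, the infimum being over countable covers by open $d$-balls of positive radius. Let $\Omega\subset\mathbb G$ be open. For $1\le p\le\infty$, a measurable horizontal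 vector field $F=\sum_{j=1}^m F_jX_j$ on $\Omega$ belongs to $\mathcal{DM}^p(H\Omega)$ if $|F|\in L^p(\Omega)$ and its distributional divergence $\phi\mapsto-\int_\Omega\langle F,\nabla_H\phi\rangle\,d\mu$, $\phi\in C_c^\infty(\Omega)$, is given by integration against a signed Radon measure on $\Omega$ (a difference of two mutually singular positive Borel measures that are finite on compact subsets of $\Omega$), denoted $\operatorname{div}F$, with total variation $|\operatorname{div}F|$. It belongs to $\mathcal{DM}^p_{\rm loc}(H\Omega)$ if $F\in\mathcal{DM}^p(HW)$ for every open $W$ whose closure is compact and contained in $\Omega$. **Theorem.** 1. Suppose $Q\ge 2$, $\frac{Q}{Q-1}\le p<\infty$, $p'=\frac{p}{p-1}$, and $F\in\mathcal{DM}^p_{\rm loc}(H\Omega)$. Then $\operatorname{div}F$ is a signed Radon measure on $\Omega$, and $|\operatorname{div}F|(B)=0$ for every Borel set $B\subset\Omega$ that is $\sigma$-finite for $\mathcal S^{Q-p'}$, i.e. a countable union of sets of finite $\mathcal S^{Q-p'}$ measure. 2. If $F\in\mathcal{DM}^\infty_{\rm loc}(H\Omega)$, then $\operatorname{div}F$ is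 a signed Radon measure on $\Omega$ and $|\operatorname{div}F|\ll\mathcal S^{Q-1}$, i.e. $|\operatorname{div}F|(B)=0$ for every Borel set $B\subset\Omega$ with $\mathcal S^{Q-1}(B)=0$. -/

import Mathlib

open MeasureTheory
open scoped ENNReal ContDiff RealInnerProductSpace

/-- A stratified Lie algebra `G = V₁ ⊕ ⋯ ⊕ V_ι`, `[V₁, V_j] = V_{j+1}`, `V_ι ≠ 0`, `V_j = 0` for
`j > ι`, with a scalar product for which some basis adapted to the layers is orthonormal (that is,
the layers are mutually orthogonal). Layers are indexed by `ℕ`, with `V₀ = 0` by convention. -/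
class StratifiedLieAlgebra (G : Type*) [NormedAddCommGroup G] [InnerProductSpace ℝ G]
    extends Bracket G G where
  add_lie' : ∀ x y z : G, ⁅x + y, z⁆ = ⁅x, z⁆ + ⁅y, z⁆
  lie_add' : ∀ x y z : G, ⁅x, y + z⁆ = ⁅x, y⁆ + ⁅x, z⁆
  lie_smul' : ∀ (t : ℝ) (x y : G), ⁅x, t • y⁆ = t • ⁅x, y⁆
  lie_self' : ∀ x : G, ⁅x, x⁆ = 0
  leibniz_lie' : ∀ x y z : G, ⁅x, ⁅y, z⁆⁆ = ⁅⁅x, y⁆, z⁆ + ⁅y, ⁅x, z⁆⁆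
  step : ℕ
  layer : ℕ → Submodule ℝ G
  step_pos : 1 ≤ step
  layer_zero : layer 0 = ⊥
  layer_step : layer step ≠ ⊥
  layer_eq_bot : ∀ j, step < j → layer j = ⊥
  isInternal : DirectSum.IsInternal layer
  orthogonal : ∀ i j, i ≠ j → layer i ⟂ layer j
  span_lie_layer : ∀ j, 1 ≤ j →
    Submodule.span ℝ {z : G | ∃ x ∈ layer 1, ∃ y ∈ layer j, ⁅x, y⁆ = z} = layer (j + 1)

namespace StratifiedLieAlgebra

variable (G : Type*) [NormedAddCommGroup G] [InnerProductSpace ℝ G] [StratifiedLieAlgebra G]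

instance instLieRing : LieRing G where
  add_lie := add_lie'
  lie_add := lie_add'
  lie_self := lie_self'
  leibniz_lie := leibniz_lie'

instance instLieAlgebra : LieAlgebra ℝ G where
  lie_smul := lie_smul'

/-- The homogeneous dimension `Q = ∑ i · dim Vᵢ`. -/
noncomputable def homDim : ℕ :=
  ∑ i ∈ Finset.range (step G + 1), i * Module.finrank ℝ (layer (G := G) i)

variable {G}

/-- The linear dilation `δ_r`, equal to multiplication by `r ^ i` on the layer `Vᵢ`. -/
noncomputable def dilation [FiniteDimensional ℝ G] (r : ℝ) : G →L[ℝ] G :=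
  ∑ i ∈ Finset.range (step G + 1), r ^ i • (layer (G := G) i).starProjection

/-- The right-nested bracket `[w₁, [w₂, … [w_{k-1}, w_k]]]` of a word. -/
def wordBracket : List G → G
  | [] => 0
  | [x] => x
  | x :: y :: w => ⁅x, wordBracket (y :: w)⁆

/-- The word `x^{r₁} y^{s₁} ⋯ x^{rₙ} y^{sₙ}`. -/
def bchWord {n : ℕ} (r s : Fin n → ℕ) (x y : G) : List G :=
  (List.ofFn fun i => List.replicate (r i) x ++ List.replicate (s i) y).flatten

/-- The Baker–Campbell–Hausdorff product, in Dynkin's form: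
`∑ₙ (-1)^{n+1}/n ∑_{rᵢ+sᵢ>0} [x^{r₁} y^{s₁} ⋯ x^{rₙ} y^{sₙ}] / ((∑ (rᵢ+sᵢ)) ∏ rᵢ! sᵢ!)`.
The sum is finite since all brackets of more than `step G` elements vanish. -/
noncomputable def bch (x y : G) : G :=
  ∑ n ∈ Finset.Icc 1 (step G),
    ∑ r : Fin n → Fin (step G + 1), ∑ s : Fin n → Fin (step G + 1),
      if ∀ i, 0 < (r i : ℕ) + (s i : ℕ) then
        ((-1 : ℝ) ^ (n + 1) / (n : ℝ) /
          ((∑ i, (((r i : ℕ) : ℝ) + ((s i : ℕ) : ℝ))) *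
            ∏ i, (((r i : ℕ).factorial : ℝ) * ((s i : ℕ).factorial : ℝ)))) •
          wordBracket (bchWord (fun i => (r i : ℕ)) (fun i => (s i : ℕ)) x y)
      else 0

end StratifiedLieAlgebra

/-- A stratified (Carnot) group, identified with its stratified Lie algebra by the exponential map:
a group whose underlying set is the Lie algebra and whose operation is given by the
Baker–Campbell–Hausdorff formula. -/
class StratifiedGroup (G : Type*) [NormedAddCommGroup G] [InnerProductSpace ℝ G]
    extends StratifiedLieAlgebra G, Group G where
  mul_eq_bch : ∀ x y : G, x * y = StratifiedLieAlgebra.bch x y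

namespace StratifiedGroup

open StratifiedLieAlgebra

section Metric

variable (G : Type*) [NormedAddCommGroup G] [InnerProductSpace ℝ G] [FiniteDimensional ℝ G]
  [StratifiedGroup G]

/-- A homogeneous distance: a continuous left invariant distance, 1-homogeneous under dilations. -/
structure HomogeneousDistance where
  toFun : G → G → ℝ
  eq_zero_iff : ∀ x y, toFun x y = 0 ↔ x = y
  symm : ∀ x y, toFun x y = toFun y x
  triangle : ∀ x y z, toFun x z ≤ toFun x y + toFun y z
  nonneg : ∀ x y, 0 ≤ toFun x y
  continuous : Continuous fun q : G × G => toFun q.1 q.2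
  left_invariant : ∀ z x y, toFun (z * x) (z * y) = toFun x y
  homogeneous : ∀ r : ℝ, 0 < r → ∀ x y, toFun (dilation r x) (dilation r y) = r * toFun x y

variable {G}

/-- The open ball `B(x, r)` of a homogeneous distance. -/
def HomogeneousDistance.ball (d : HomogeneousDistance G) (x : G) (r : ℝ) : Set G :=
  {y | d.toFun y x < r}

/-- The premeasure `S^α_δ`: infimum of `∑ r_j ^ α` over countable covers by open balls
`B(x_j, r_j)` with `2 r_j < δ`. -/
noncomputable def HomogeneousDistance.sphericalPre (d : HomogeneousDistance G) (α δ : ℝ)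
    (A : Set G) : ℝ≥0∞ :=
  ⨅ (J : Set ℕ) (x : ℕ → G) (r : ℕ → ℝ) (_ : ∀ j ∈ J, 0 < r j ∧ 2 * r j < δ)
    (_ : A ⊆ ⋃ j ∈ J, d.ball (x j) (r j)), ∑' j : J, ENNReal.ofReal (r j ^ α)

/-- The spherical (outer) measure `S^α = sup_{δ > 0} S^α_δ`. -/
noncomputable def HomogeneousDistance.spherical (d : HomogeneousDistance G) (α : ℝ)
    (A : Set G) : ℝ≥0∞ :=
  ⨆ (δ : ℝ) (_ : 0 < δ), d.sphericalPre α δ A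

/-- `B` is `σ`-finite for `S^α`: a countable union of sets of finite `S^α` measure. -/
def HomogeneousDistance.IsSphericalSigmaFinite (d : HomogeneousDistance G) (α : ℝ)
    (B : Set G) : Prop :=
  ∃ A : ℕ → Set G, B = ⋃ n, A n ∧ ∀ n, d.spherical α (A n) < ⊤

end Metric

section Divergence

variable {G : Type*} [NormedAddCommGroup G] [InnerProductSpace ℝ G] [FiniteDimensional ℝ G]
  [MeasurableSpace G] [BorelSpace G] [StratifiedGroup G]

/-- The action on `f` of the left invariant vector field `X` with `X(0) = v`. Since `t ↦ t • v` is
the one-parameter subgroup of `v`, `(X f)(x) = d/dt f (x * (t • v))` at `t = 0`. -/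
noncomputable def leftInvDeriv (v : G) (f : G → ℝ) (x : G) : ℝ :=
  deriv (fun t : ℝ => f (x * (t • v))) 0

/-- The horizontal gradient `∑ (X_j f) X_j`, for an orthonormal basis `(X_j)` of the first layer.
Horizontal fibres are identified with the first layer by left translation, so that a horizontal
field `∑ F_j X_j` is the `V₁`-valued map `x ↦ ∑ F_j(x) e_j`, and the left invariant metric is the
scalar product of `V₁`. -/
noncomputable def horizontalGradient (f : G → ℝ) (x : G) : layer (G := G) 1 :=
  ∑ j, leftInvDeriv ((stdOrthonormalBasis ℝ (layer (G := G) 1) j : layer (G := G) 1) : G) f x •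
    stdOrthonormalBasis ℝ (layer (G := G) 1) j

/-- A (possibly infinite) signed Radon measure on an open set `Ω`, given by its Jordan
decomposition: mutually singular Borel measures on `Ω`, finite on the compact subsets of `Ω`.
A measure on `Ω` is seen as a measure on `G` that vanishes outside `Ω`. -/
structure SignedRadonMeasure (Ω : Set G) where
  pos : Measure G
  neg : Measure G
  mutuallySingular : pos ⟂ₘ neg
  pos_compl : pos Ωᶜ = 0
  neg_compl : neg Ωᶜ = 0
  pos_lt_top : ∀ K : Set G, IsCompact K → K ⊆ Ω → pos K < ⊤
  neg_lt_top : ∀ K : Set G, IsCompact K → K ⊆ Ω → neg K < ⊤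

/-- The total variation `|ν|`. -/
noncomputable def SignedRadonMeasure.variation {Ω : Set G} (ν : SignedRadonMeasure Ω) : Measure G :=
  ν.pos + ν.neg

/-- The distributional divergence `φ ↦ -∫_Ω ⟨F, ∇_H φ⟩ dμ`, `φ ∈ C_c^∞(Ω)`, of the horizontal
field `F` is the signed Radon measure `ν` on `Ω`. -/
def IsDivergence (μ : Measure G) (Ω : Set G) (F : G → layer (G := G) 1)
    (ν : SignedRadonMeasure Ω) : Prop :=
  ∀ φ : G → ℝ, ContDiff ℝ ∞ φ → HasCompactSupport φ → tsupport φ ⊆ Ω →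
    -∫ x in Ω, ⟪F x, horizontalGradient φ x⟫ ∂μ = ∫ x, φ x ∂ν.pos - ∫ x, φ x ∂ν.neg

/-- `F ∈ DM^p(HΩ)`: `F` is `p`-summable on `Ω` and `div F` is a Radon measure on `Ω`. -/
def IsDM (μ : Measure G) (p : ℝ≥0∞) (Ω : Set G) (F : G → layer (G := G) 1) : Prop :=
  MemLp F p (μ.restrict Ω) ∧ ∃ ν : SignedRadonMeasure Ω, IsDivergence μ Ω F ν

/-- `F ∈ DM^p_loc(HΩ)`: `F ∈ DM^p(HW)` for each open `W` with compact closure contained in `Ω`. -/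
def IsDMLoc (μ : Measure G) (p : ℝ≥0∞) (Ω : Set G) (F : G → layer (G := G) 1) : Prop :=
  ∀ W : Set G, IsOpen W → IsCompact (closure W) → closure W ⊆ Ω → IsDM μ p W F

end Divergence

end StratifiedGroup

/-! The divergence is tested against cutoffs `φ` equal to `1` on a compact `K ⊆ B` and supported
near `K`. Split `B` by a Hahn set of `div F`. If `K` lies in the part where the negative measure
vanishes, then `(div F)⁺(K) ≤ ∫ φ d(div F)⁺`, which is at most `|∫ ⟨F, ∇_H φ⟩|` plus the negative
mass near `K`, and that mass is small by outer regularity. So it suffices to find cutoffs with `∫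
⟨F, ∇_H φ⟩` arbitrarily small; inner regularity then passes from compact sets to `B`. This is
`IsDivergence.variation_eq_zero`.

The cutoffs come from a capacity estimate, `HomogeneousDistance.exists_testFunction`: if `S^{Q-q}(K)
< M`, some `φ` supported in a prescribed neighbourhood has `∫ |∇_H φ|^q ≤ C M`. Cover `K` by
finitely many balls of radii `r_j` with `∑ r_j^{Q-q} ≤ M`, take rescaled bumps `η_j` with gradient
of order `1/r_j`, and set `φ = H(∑ η_j^{N+1})` for a smooth step `H`. A weighted power-mean
inequality gives `|∇_H φ|^q ≤ C ∑ r_j^{-q} 1_{B(x_j, R r_j)}` however much the balls overlap, and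
`μ(B(x, r))` is a constant times `r^Q`.

For `p = ∞` take `q = 1`: since `S^{Q-1}(K) = 0`, `M` can be as small as desired. For finite `p`
take `q = p'`: the capacity is only bounded, but finiteness of `S^{Q-q}(K)` forces `μ(K) = 0`, so
`F` has small `L^p` norm near `K` and Hölder's inequality concludes.

That `div F` is a Radon measure on all of `Ω` follows by gluing the local divergences along an
exhaustion. -/

namespace StratifiedLieAlgebra

/-! ### Words, brackets and the Baker–Campbell–Hausdorff sum. -/

section Words

variable {G : Type*}

theorem bchWord_map {G' : Type*} (f : G → G') {n : ℕ} (r s : Fin n → ℕ) (x y : G) :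
    (bchWord r s x y).map f =
      (List.ofFn fun i => List.replicate (r i) (f x) ++ List.replicate (s i) (f y)).flatten := by
  simp [bchWord, List.map_flatten, List.map_ofFn, Function.comp_def]

theorem mem_bchWord {n : ℕ} {r s : Fin n → ℕ} {x y a : G} (ha : a ∈ bchWord r s x y) :
    a = x ∨ a = y := by
  simp only [bchWord, List.mem_flatten, List.mem_ofFn] at ha
  obtain ⟨l, ⟨i, rfl⟩, hl⟩ := ha
  rcases List.mem_append.1 hl with h | h
  · exact Or.inl (List.eq_of_mem_replicate h)
  · exact Or.inr (List.eq_of_mem_replicate h)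

theorem length_bchWord {n : ℕ} (r s : Fin n → ℕ) (x y : G) :
    (bchWord r s x y).length = ∑ i, (r i + s i) := by
  simp [bchWord, List.length_flatten, List.map_ofFn, Function.comp_def, List.sum_ofFn]

end Words

section Algebra

variable {G : Type*} [NormedAddCommGroup G] [InnerProductSpace ℝ G] [StratifiedLieAlgebra G]

theorem lie_mem_layer_one {x y : G} {j : ℕ} (hx : x ∈ layer (G := G) 1)
    (hy : y ∈ layer (G := G) j) : ⁅x, y⁆ ∈ layer (G := G) (j + 1) := by
  rcases Nat.eq_zero_or_pos j with rfl | hj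
  · rw [layer_zero, Submodule.mem_bot] at hy
    rw [hy, lie_zero]
    exact zero_mem _
  · rw [← span_lie_layer j hj]
    exact Submodule.subset_span ⟨x, hx, y, hy, rfl⟩

/-- The first layer generates: by the Jacobi identity a bracket with `[a, b]`, `a ∈ V₁`, reduces to
brackets with `a` and with `b`, which lies one layer lower. The induction on `i` must leave `j`
free, because `[a, y]` moves up a layer. -/
theorem lie_mem_layer {i j : ℕ} {x y : G} (hx : x ∈ layer (G := G) i)
    (hy : y ∈ layer (G := G) j) : ⁅x, y⁆ ∈ layer (G := G) (i + j) := by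
  induction i generalizing x y j with
  | zero =>
    rw [layer_zero, Submodule.mem_bot] at hx
    rw [hx, zero_lie]
    exact zero_mem _
  | succ i ih =>
    rcases Nat.eq_zero_or_pos i with rfl | hi
    · rw [zero_add, add_comm]
      exact lie_mem_layer_one hx hy
    · rw [← span_lie_layer i hi] at hx
      induction hx using Submodule.span_induction with
      | mem z hz =>
        obtain ⟨a, ha, b, hb, rfl⟩ := hz
        rw [lie_lie]
        refine sub_mem ?_ ?_
        · have := lie_mem_layer_one ha (ih hb hy)
          rwa [show i + 1 + j = i + j + 1 by ring]
        · have := ih hb (lie_mem_layer_one ha hy)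
          rwa [show i + 1 + j = i + (j + 1) by ring]
      | zero => rw [zero_lie]; exact zero_mem _
      | add a b _ _ ha hb => rw [add_lie]; exact add_mem ha hb
      | smul t a _ ha => rw [smul_lie]; exact Submodule.smul_mem _ _ ha

theorem linearMap_ext_layer {E : Type*} [AddCommGroup E] [Module ℝ E] {f g : G →ₗ[ℝ] E}
    (h : ∀ i, ∀ x ∈ layer (G := G) i, f x = g x) : f = g := by
  refine LinearMap.ext fun x => ?_
  have hx : x ∈ ⨆ i, layer (G := G) i := by
    rw [(isInternal (G := G)).submodule_iSup_eq_top]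
    trivial
  induction hx using Submodule.iSup_induction' with
  | mem i x hx => exact h i x hx
  | zero => rw [map_zero, map_zero]
  | add x y _ _ hx hy => rw [map_add, map_add, hx, hy]

/-- The Lie bracket as a bilinear map. -/
def lieBilin : G →ₗ[ℝ] G →ₗ[ℝ] G :=
  LinearMap.mk₂ ℝ (fun x y => ⁅x, y⁆) add_lie smul_lie lie_add fun t x y => lie_smul t x y

theorem wordBracket_map (f : G →ₗ[ℝ] G) (hf : ∀ x y : G, f ⁅x, y⁆ = ⁅f x, f y⁆) (w : List G) :
    wordBracket (w.map f) = f (wordBracket w) := by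
  induction w with
  | nil => simp [wordBracket]
  | cons x w ih =>
    cases w with
    | nil => simp [wordBracket]
    | cons y w =>
      rw [List.map_cons, List.map_cons, wordBracket, wordBracket, hf, ← ih, List.map_cons]

theorem bch_map (f : G →ₗ[ℝ] G) (hf : ∀ x y : G, f ⁅x, y⁆ = ⁅f x, f y⁆) (x y : G) :
    bch (f x) (f y) = f (bch x y) := by
  unfold bch
  simp only [map_sum]
  refine Finset.sum_congr rfl fun n _ => Finset.sum_congr rfl fun r _ =>
    Finset.sum_congr rfl fun s _ => ?_
  split_ifs
  · rw [map_smul, ← wordBracket_map f hf, bchWord_map]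
    rfl
  · rw [map_zero]

/-- In a word of length at least two the innermost bracket is that of two multiples of `z`; the
empty word has bracket `0` by convention. -/
theorem wordBracket_eq_zero {z : G} {w : List G} (hw : ∀ x ∈ w, ∃ t : ℝ, x = t • z)
    (h : w.length ≠ 1) : wordBracket w = 0 := by
  induction w with
  | nil => rfl
  | cons x w ih =>
    cases w with
    | nil => simp at h
    | cons y w =>
      rw [wordBracket]
      by_cases hl : (y :: w).length = 1
      · have : w = [] := by simpa using hl
        subst this
        obtain ⟨s, rfl⟩ := hw x (by simp)
        obtain ⟨t, rfl⟩ := hw y (by simp)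
        simp [wordBracket]
      · rw [ih (fun a ha => hw a (List.mem_cons_of_mem _ ha)) hl, lie_zero]

/-- Only words of length one survive, so only `n = 1` contributes. This makes lines through the
origin one-parameter subgroups, from which the unit and the inverses of the group are read off. -/
theorem bch_smul_smul (s t : ℝ) (z : G) : bch (s • z) (t • z) = (s + t) • z := by
  have hz : ∀ {n : ℕ} {r u : Fin n → ℕ}, (∑ i, (r i + u i)) ≠ 1 →
      wordBracket (bchWord r u (s • z) (t • z)) = 0 := by
    intro n r u h
    refine wordBracket_eq_zero (z := z) (fun a ha => ?_) (by rwa [length_bchWord])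
    rcases mem_bchWord ha with h | h
    · exact ⟨s, h⟩
    · exact ⟨t, h⟩
  have h1 : 1 ∈ Finset.Icc 1 (step G) := Finset.mem_Icc.2 ⟨le_rfl, step_pos⟩
  unfold bch
  rw [Finset.sum_eq_single_of_mem 1 h1]
  · obtain ⟨k, hk⟩ : ∃ k, step G = k + 1 := ⟨step G - 1, (Nat.sub_add_cancel step_pos).symm⟩
    rw [hk]
    -- The numeral `1` of `Fin (step + 1)` really has value `1`, because the step is positive.
    have hmod : 1 % (1 + (k + 1)) = 1 := Nat.mod_eq_of_lt (by omega)
    -- The words of length one are given by the exponents `(0, 1)` and `(1, 0)`.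
    rw [Fintype.sum_eq_add (fun _ : Fin 1 => (0 : Fin (k + 1 + 1))) (fun _ => 1)]
    · rw [Fintype.sum_eq_single (fun _ : Fin 1 => (1 : Fin (k + 1 + 1))),
        Fintype.sum_eq_single (fun _ : Fin 1 => (0 : Fin (k + 1 + 1)))]
      · simp [bchWord, wordBracket, add_smul, add_comm, hmod]
      · intro u hu
        have hu0 : (u 0 : ℕ) ≠ 0 := fun h => hu (funext fun i => by
          rw [Subsingleton.elim i 0]; exact Fin.ext (by simpa using h))
        rw [hz (by simpa [hmod, add_comm] using hu0), smul_zero, ite_self]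
      · intro u hu
        have : (u 0 : ℕ) ≠ 1 := fun h => hu (funext fun i => by
          rw [Subsingleton.elim i 0]; exact Fin.ext (by simpa [hmod, add_comm] using h))
        rw [hz (by simp [add_comm]; omega), smul_zero, ite_self]
    · intro h
      have := congrFun h 0
      simp at this
    · rintro r ⟨hr0, hr1⟩
      have h0 : (r 0 : ℕ) ≠ 0 := fun h => hr0 (funext fun i => by
          rw [Subsingleton.elim i 0]; exact Fin.ext (by simpa using h))
      have h1 : (r 0 : ℕ) ≠ 1 := fun h => hr1 (funext fun i => by
          rw [Subsingleton.elim i 0]; exact Fin.ext (by simpa [hmod, add_comm] using h))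
      refine Finset.sum_eq_zero fun u _ => ?_
      rw [hz (by simp; omega), smul_zero, ite_self]
  · intro n hn hn1
    refine Finset.sum_eq_zero fun r _ => Finset.sum_eq_zero fun u _ => ?_
    split_ifs with h
    · rw [hz, smul_zero]
      have : ∑ i : Fin n, 1 ≤ ∑ i, ((r i : ℕ) + (u i : ℕ)) :=
        Finset.sum_le_sum fun i _ => h i
      have h2 := (Finset.mem_Icc.1 hn).1
      simp only [Finset.sum_const, Finset.card_univ, Fintype.card_fin, smul_eq_mul, mul_one] at this
      omega
    · rfl

end Algebra

/-! ### Dilations and smoothness of the group law. -/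

section FiniteDim

variable {G : Type*} [NormedAddCommGroup G] [InnerProductSpace ℝ G] [FiniteDimensional ℝ G]
  [StratifiedLieAlgebra G]

theorem dilation_apply_of_mem (r : ℝ) {i : ℕ} {x : G} (hx : x ∈ layer (G := G) i) :
    dilation r x = r ^ i • x := by
  have hne : ∀ j, j ≠ i → (layer (G := G) j).starProjection x = 0 := fun j hj =>
    (Submodule.starProjection_apply_eq_zero_iff _).2 ((orthogonal j i hj).symm hx)
  simp only [dilation, sum_apply, smul_apply]
  by_cases hi : i ∈ Finset.range (step G + 1)
  · rw [Finset.sum_eq_single_of_mem i hi fun j _ hj => by rw [hne j hj, smul_zero],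
      Submodule.starProjection_eq_self_iff.2 hx]
  · have : x = 0 := by
      rw [layer_eq_bot i (by simpa [Nat.lt_succ_iff] using hi)] at hx
      exact hx
    simp [this]

theorem dilation_comp (r s : ℝ) (x : G) : dilation r (dilation s x) = dilation (r * s) x := by
  have : (dilation r : G →L[ℝ] G).toLinearMap ∘ₗ (dilation s : G →L[ℝ] G).toLinearMap =
      (dilation (r * s) : G →L[ℝ] G).toLinearMap := by
    refine linearMap_ext_layer fun i x hx => ?_
    simp only [LinearMap.comp_apply, ContinuousLinearMap.coe_coe]
    rw [dilation_apply_of_mem s hx, map_smul, dilation_apply_of_mem r hx,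
      dilation_apply_of_mem _ hx, smul_smul, mul_pow, mul_comm]
  exact LinearMap.congr_fun this x

theorem dilation_one (x : G) : dilation 1 x = x := by
  have : (dilation 1 : G →L[ℝ] G).toLinearMap = LinearMap.id :=
    linearMap_ext_layer fun i x hx => by simp [dilation_apply_of_mem 1 hx]
  exact LinearMap.congr_fun this x

theorem dilation_zero (x : G) : dilation 0 x = 0 := by
  have : (dilation 0 : G →L[ℝ] G).toLinearMap = 0 := by
    refine linearMap_ext_layer fun i x hx => ?_
    rw [ContinuousLinearMap.coe_coe, dilation_apply_of_mem 0 hx]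
    rcases Nat.eq_zero_or_pos i with rfl | hi
    · rw [layer_zero] at hx
      simpa using hx
    · simp [hi.ne']
  exact LinearMap.congr_fun this x

theorem dilation_inv_dilation {r : ℝ} (hr : r ≠ 0) (x : G) : dilation r⁻¹ (dilation r x) = x := by
  rw [dilation_comp, inv_mul_cancel₀ hr, dilation_one]

theorem dilation_dilation_inv {r : ℝ} (hr : r ≠ 0) (x : G) : dilation r (dilation r⁻¹ x) = x := by
  rw [dilation_comp, mul_inv_cancel₀ hr, dilation_one]

/-- On `V_i × V_j` both sides are `r ^ (i + j)` times the bracket, by the grading; bilinearity does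
the rest. -/
theorem dilation_lie (r : ℝ) (x y : G) : dilation r ⁅x, y⁆ = ⁅dilation r x, dilation r y⁆ := by
  have : lieBilin.compr₂ (dilation r : G →L[ℝ] G).toLinearMap =
      lieBilin.compl₁₂ (dilation r : G →L[ℝ] G).toLinearMap
        (dilation r : G →L[ℝ] G).toLinearMap := by
    refine linearMap_ext_layer fun i x hx => linearMap_ext_layer fun j y hy => ?_
    simp only [LinearMap.compr₂_apply, LinearMap.compl₁₂_apply, lieBilin, LinearMap.mk₂_apply,
      ContinuousLinearMap.coe_coe]
    rw [dilation_apply_of_mem r (lie_mem_layer hx hy), dilation_apply_of_mem r hx,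
      dilation_apply_of_mem r hy, smul_lie, lie_smul, smul_smul, pow_add]
  exact LinearMap.congr_fun₂ this x y

theorem bch_dilation (r : ℝ) (x y : G) :
    bch (dilation r x) (dilation r y) = dilation r (bch x y) :=
  bch_map (dilation r : G →L[ℝ] G).toLinearMap (dilation_lie r) x y

theorem continuous_dilation (x : G) : Continuous fun r : ℝ => dilation r x := by
  simp only [dilation, sum_apply, smul_apply]
  fun_prop

theorem contDiff_lie {E : Type*} [NormedAddCommGroup E] [NormedSpace ℝ E] {f g : E → G}
    (hf : ContDiff ℝ ∞ f) (hg : ContDiff ℝ ∞ g) : ContDiff ℝ ∞ fun e => ⁅f e, g e⁆ := by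
  have h : IsBoundedBilinearMap ℝ fun p : G × G => ⁅p.1, p.2⁆ := by
    have := (LinearMap.toContinuousBilinearMap (lieBilin (G := G))).isBoundedBilinearMap
    exact this
  exact h.contDiff.comp (hf.prodMk hg)

theorem contDiff_wordBracket {E : Type*} [NormedAddCommGroup E] [NormedSpace ℝ E]
    (w : List (E → G)) (hw : ∀ f ∈ w, ContDiff ℝ ∞ f) :
    ContDiff ℝ ∞ fun e => wordBracket (w.map fun f => f e) := by
  induction w with
  | nil => exact contDiff_const
  | cons f w ih =>
    cases w with
    | nil => exact hw f (by simp)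
    | cons g w =>
      simp only [List.map_cons, wordBracket]
      exact contDiff_lie (hw f (by simp)) (ih fun a ha => hw a (List.mem_cons_of_mem _ ha))

theorem contDiff_bch : ContDiff ℝ ∞ fun p : G × G => bch p.1 p.2 := by
  unfold bch
  refine ContDiff.sum fun n _ => ContDiff.sum fun r _ => ContDiff.sum fun s _ => ?_
  split_ifs
  · refine contDiff_const.smul ?_
    have := contDiff_wordBracket (G := G) ((List.ofFn fun i : Fin n =>
      List.replicate (r i : ℕ) (Prod.fst : G × G → G) ++
        List.replicate (s i : ℕ) (Prod.snd : G × G → G)).flatten) (by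
      intro f hf
      simp only [List.mem_flatten, List.mem_ofFn] at hf
      obtain ⟨l, ⟨i, rfl⟩, hl⟩ := hf
      rcases List.mem_append.1 hl with h | h
      · rw [List.eq_of_mem_replicate h]; exact contDiff_fst
      · rw [List.eq_of_mem_replicate h]; exact contDiff_snd)
    convert this using 3 with p
    simp [bchWord, List.map_flatten, List.map_ofFn, Function.comp_def]
  · exact contDiff_const

theorem det_dilation (r : ℝ) :
    LinearMap.det (dilation r : G →L[ℝ] G).toLinearMap = r ^ homDim G := by
  classical
  let b := (isInternal (G := G)).collectedBasis fun i => Module.finBasis ℝ (layer (G := G) i)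
  have hmem : ∀ a, b a ∈ layer (G := G) a.1 := fun a =>
    DirectSum.IsInternal.collectedBasis_mem _ _ a
  let _ : Fintype (Σ i, Fin (Module.finrank ℝ (layer (G := G) i))) :=
    FiniteDimensional.fintypeBasisIndex b
  have hM : LinearMap.toMatrix b b (dilation r : G →L[ℝ] G).toLinearMap =
      Matrix.diagonal fun a => r ^ a.1 := by
    ext a c
    rw [LinearMap.toMatrix_apply, ContinuousLinearMap.coe_coe, dilation_apply_of_mem r (hmem c),
      map_smul, b.repr_self, Matrix.diagonal_apply]
    by_cases h : a = c
    · subst h; simp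
    · simp [h]
  rw [← LinearMap.det_toMatrix b, hM, Matrix.det_diagonal, Finset.prod_pow_eq_pow_sum, homDim]
  congr 1
  -- The basis is indexed over all layers in `ℕ`; those beyond the step are zero and contribute no
  -- index.
  have huniv : (Finset.univ : Finset (Σ i, Fin (Module.finrank ℝ (layer (G := G) i)))) =
      (Finset.range (step G + 1)).sigma fun _ => Finset.univ := by
    ext ⟨i, j⟩
    simp only [Finset.mem_univ, Finset.mem_sigma, Finset.mem_range, and_true, true_iff]
    by_contra hi
    have hb := layer_eq_bot (G := G) i (by omega)
    have hf : Module.finrank ℝ (layer (G := G) i) = 0 := by rw [hb, finrank_bot]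
    have := j.2
    omega
  rw [huniv, Finset.sum_sigma]
  simp [mul_comm]

end FiniteDim

end StratifiedLieAlgebra

namespace StratifiedGroup

open StratifiedLieAlgebra Filter Topology

/-! ### The group operation in exponential coordinates. -/

section Operation

variable {G : Type*} [NormedAddCommGroup G] [InnerProductSpace ℝ G] [StratifiedGroup G]

theorem smul_mul_smul_same (s t : ℝ) (x : G) : (s • x) * (t • x) = (s + t) • x := by
  rw [mul_eq_bch, bch_smul_smul]

theorem mul_zero_eq (x : G) : x * 0 = x := by
  simpa using smul_mul_smul_same 1 0 x

/-- The unit is an abstract datum of the group; it is identified by the fact that `0` is a right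
unit. -/
theorem one_eq_zero : (1 : G) = 0 := by
  rw [← mul_zero_eq (1 : G), one_mul]

theorem zero_mul_eq (x : G) : 0 * x = x := by
  rw [← one_eq_zero, one_mul]

theorem inv_eq_neg (x : G) : x⁻¹ = -x := by
  refine inv_eq_of_mul_eq_one_right ?_
  simpa [one_eq_zero] using smul_mul_smul_same 1 (-1) x

variable [FiniteDimensional ℝ G]

theorem dilation_mul (r : ℝ) (x y : G) :
    dilation r (x * y) = dilation r x * dilation r y := by
  rw [mul_eq_bch, mul_eq_bch, bch_dilation]

theorem contDiff_mul_prod : ContDiff ℝ ∞ fun p : G × G => p.1 * p.2 := by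
  simp only [mul_eq_bch]
  exact contDiff_bch

instance instIsTopologicalGroup : IsTopologicalGroup G where
  continuous_mul := contDiff_mul_prod.continuous
  continuous_inv := by
    simp only [inv_eq_neg]
    exact continuous_neg

theorem contDiff_mul_left (x : G) : ContDiff ℝ ∞ fun y : G => x * y :=
  contDiff_mul_prod.comp (contDiff_const.prodMk contDiff_id)

theorem fderiv_mul_left (x y : G) :
    fderiv ℝ (fun z : G => x * z) y =
      (fderiv ℝ (fun p : G × G => p.1 * p.2) (x, y)).comp (ContinuousLinearMap.inr ℝ G G) := by
  have h1 : HasFDerivAt (fun p : G × G => p.1 * p.2)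
      (fderiv ℝ (fun p : G × G => p.1 * p.2) (x, y)) (x, y) :=
    (contDiff_mul_prod.differentiable (by simp) _).hasFDerivAt
  exact (h1.comp y (hasFDerivAt_prodMk_right x y)).fderiv

theorem continuous_fderiv_mul_left :
    Continuous fun p : G × G => fderiv ℝ (fun z : G => p.1 * z) p.2 := by
  simp only [fderiv_mul_left]
  have := (contDiff_mul_prod (G := G)).continuous_fderiv (by simp)
  exact (this.comp (continuous_fst.prodMk continuous_snd)).clm_comp continuous_const

/-- Left translations have Jacobian `1` with respect to the linear structure. -/
theorem det_fderiv_mul_left (x y : G) : (fderiv ℝ (fun z : G => x * z) y).det = 1 := by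
  -- Dilations conjugate left translations, so the Jacobian at `(δ_r x, δ_r y)` does not depend on
  -- `r > 0`. As `r → 0` it tends to the Jacobian of translation by `0`, the identity.
  have hcont : Continuous fun r : ℝ =>
      (fderiv ℝ (fun z : G => dilation r x * z) (dilation r y)).det :=
    ContinuousLinearMap.continuous_det.comp
      (continuous_fderiv_mul_left.comp ((continuous_dilation x).prodMk (continuous_dilation y)))
  have h0 : (fderiv ℝ (fun z : G => dilation 0 x * z) (dilation 0 y)).det = 1 := by
    simp only [dilation_zero, zero_mul_eq]
    rw [fderiv_fun_id]
    exact LinearMap.det_id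
  have hr : ∀ r : ℝ, 0 < r → (fderiv ℝ (fun z : G => dilation r x * z) (dilation r y)).det =
      (fderiv ℝ (fun z : G => x * z) y).det := by
    intro r hr
    have hfun : (fun z : G => dilation r x * z) =
        fun z => dilation r (x * dilation r⁻¹ z) := by
      funext z
      rw [dilation_mul, dilation_dilation_inv hr.ne']
    have hd : HasFDerivAt (fun z : G => dilation r x * z)
        ((dilation r : G →L[ℝ] G).comp ((fderiv ℝ (fun z : G => x * z) y).comp (dilation r⁻¹)))
        (dilation r y) := by
      rw [hfun]
      refine (dilation r : G →L[ℝ] G).hasFDerivAt.comp _ ?_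
      have h1 : HasFDerivAt (fun z : G => x * z) (fderiv ℝ (fun z : G => x * z) y)
          (dilation r⁻¹ (dilation r y)) := by
        rw [dilation_inv_dilation hr.ne']
        exact ((contDiff_mul_left x).differentiable (by simp) _).hasFDerivAt
      exact h1.comp _ (dilation r⁻¹ : G →L[ℝ] G).hasFDerivAt
    have hdet : LinearMap.det (dilation r : G →L[ℝ] G).toLinearMap *
        LinearMap.det (dilation r⁻¹ : G →L[ℝ] G).toLinearMap = 1 := by
      rw [det_dilation, det_dilation, ← mul_pow, mul_inv_cancel₀ hr.ne', one_pow]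
    rw [hd.fderiv]
    change LinearMap.det ((dilation r : G →L[ℝ] G).toLinearMap ∘ₗ
      ((fderiv ℝ (fun z : G => x * z) y).toLinearMap ∘ₗ
        (dilation r⁻¹ : G →L[ℝ] G).toLinearMap)) = _
    rw [LinearMap.det_comp, LinearMap.det_comp, mul_left_comm, hdet, mul_one]
  have hlim := (hcont.tendsto 0).mono_left (nhdsWithin_le_nhds (s := Set.Ioi 0))
  rw [h0] at hlim
  refine tendsto_nhds_unique (hlim.congr' ?_) tendsto_const_nhds |>.symm
  filter_upwards [self_mem_nhdsWithin] with r h using hr r h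

end Operation

/-! ### Haar measure and its scaling. -/

section Haar

variable {G : Type*} [NormedAddCommGroup G] [InnerProductSpace ℝ G] [FiniteDimensional ℝ G]
  [MeasurableSpace G] [BorelSpace G] [StratifiedGroup G]

/-- A Lebesgue measure is a Haar measure of the group. -/
theorem isHaarMeasure_of_isAddHaarMeasure (ν : Measure G) [ν.IsAddHaarMeasure] :
    ν.IsHaarMeasure where
  lt_top_of_isCompact := fun _ hK => hK.measure_lt_top
  open_pos := fun _ hU hne => (hU.measure_pos ν hne).ne'
  map_mul_left_eq_self := by
    intro x
    ext s hs
    have hpre : (fun y => x * y) ⁻¹' s = (fun y => x⁻¹ * y) '' s := by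
      ext y
      constructor
      · exact fun hy => ⟨x * y, hy, by simp⟩
      · rintro ⟨z, hz, rfl⟩
        simpa using hz
    rw [Measure.map_apply (measurable_const_mul x) hs, hpre,
      ← lintegral_abs_det_fderiv_eq_addHaar_image ν hs
        (f' := fun y => fderiv ℝ (fun z : G => x⁻¹ * z) y)
        (fun y _ =>
          ((contDiff_mul_left x⁻¹).differentiable (by simp) y).hasFDerivAt.hasFDerivWithinAt)
        ((mul_right_injective x⁻¹).injOn)]
    simp [det_fderiv_mul_left]

/-- By uniqueness of Haar measure it is enough to scale a Lebesgue measure, where the factor is the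
determinant. -/
theorem measure_image_dilation (μ : Measure G) [μ.IsHaarMeasure] {r : ℝ} (hr : 0 < r)
    (s : Set G) : μ (dilation r '' s) = ENNReal.ofReal (r ^ homDim G) * μ s := by
  let ν : Measure G := Measure.addHaar
  have := isHaarMeasure_of_isAddHaarMeasure ν
  rw [Measure.isMulLeftInvariant_eq_smul μ ν, Measure.smul_apply, Measure.smul_apply,
    Measure.addHaar_image_continuousLinearMap, det_dilation, abs_of_pos (pow_pos hr _)]
  simp only [ENNReal.smul_def, smul_eq_mul]
  ring

end Haar

/-! ### Balls of a homogeneous distance. -/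

namespace HomogeneousDistance

variable {G : Type*} [NormedAddCommGroup G] [InnerProductSpace ℝ G] [FiniteDimensional ℝ G]
  [StratifiedGroup G] (d : HomogeneousDistance G)

theorem eq_inv_mul (x y : G) : d.toFun y x = d.toFun (x⁻¹ * y) 0 := by
  rw [← d.left_invariant x⁻¹ y x, inv_mul_cancel, one_eq_zero]

theorem dilation_zero_right {r : ℝ} (hr : 0 < r) (x : G) :
    d.toFun (dilation r x) 0 = r * d.toFun x 0 := by
  simpa using d.homogeneous r hr x 0

theorem continuous_left (y : G) : Continuous fun x => d.toFun x y :=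
  d.continuous.comp (continuous_id.prodMk continuous_const)

theorem isOpen_ball (x : G) (r : ℝ) : IsOpen (d.ball x r) :=
  isOpen_lt (d.continuous_left x) continuous_const

/-- Take for `m` the minimum of `d(·, 0)` on the Euclidean sphere of radius `ε`. If `‖z‖ ≥ ε`, the
curve `r ↦ δ_r z`, `0 ≤ r ≤ 1`, crosses that sphere, at a point no farther from `0` than `z` is. -/
theorem exists_norm_lt {ε : ℝ} (hε : 0 < ε) : ∃ m > 0, ∀ z, d.toFun z 0 < m → ‖z‖ < ε := by
  obtain ⟨v, -, hv⟩ := Submodule.exists_mem_ne_zero_of_ne_bot (layer_step (G := G))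
  have : Nontrivial G := ⟨v, 0, hv⟩
  obtain ⟨w, hw, hmin⟩ := (isCompact_sphere (0 : G) ε).exists_isMinOn
    (NormedSpace.sphere_nonempty.2 hε.le) (d.continuous_left 0).continuousOn
  have hw0 : w ≠ 0 := by
    rintro rfl
    simp [hε.ne] at hw
  refine ⟨d.toFun w 0, (d.nonneg _ _).lt_of_ne fun h => hw0 ((d.eq_zero_iff _ _).1 h.symm), ?_⟩
  intro z hz
  by_contra! hzε
  obtain ⟨r, hr, hrz⟩ := intermediate_value_Icc (zero_le_one' ℝ)
    (continuous_dilation z).norm.continuousOn (show ε ∈ Set.Icc _ _ from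
      ⟨by simp [dilation_zero, hε.le], by simpa [dilation_one] using hzε⟩)
  have hr0 : 0 < r := hr.1.lt_of_ne (by
    rintro rfl
    simp [dilation_zero, hε.ne] at hrz)
  have h1 : d.toFun w 0 ≤ d.toFun (dilation r z) 0 := hmin (by simpa using hrz)
  rw [d.dilation_zero_right hr0] at h1
  nlinarith [d.nonneg z 0, hr.2]

theorem exists_forall_mem_of_mem_nhds {V : Set G} (hV : V ∈ 𝓝 (0 : G)) :
    ∃ δ > 0, ∀ z, d.toFun z 0 < δ → z ∈ V := by
  obtain ⟨ε, hε, h⟩ := Metric.mem_nhds_iff.1 hV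
  obtain ⟨δ, hδ, h'⟩ := d.exists_norm_lt hε
  exact ⟨δ, hδ, fun z hz => h (by simpa using h' z hz)⟩

theorem ball_eq_image (x : G) {r : ℝ} (hr : 0 < r) :
    d.ball x r = (fun y => x * y) '' (dilation r '' d.ball 0 1) := by
  ext y
  simp only [ball, Set.mem_ofPred_eq, Set.mem_image, exists_exists_and_eq_and]
  rw [d.eq_inv_mul x y]
  constructor
  · intro h
    refine ⟨dilation r⁻¹ (x⁻¹ * y), ?_, ?_⟩
    · rw [d.dilation_zero_right (inv_pos.2 hr), inv_mul_lt_iff₀ hr, mul_one]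
      exact h
    · rw [dilation_dilation_inv hr.ne', mul_inv_cancel_left]
  · rintro ⟨z, hz, rfl⟩
    rw [inv_mul_cancel_left, d.dilation_zero_right hr]
    nlinarith

/-- A dilation brings the ball of radius `R` into one already known to be norm bounded. Hence balls
are relatively compact and have finite measure. -/
theorem exists_norm_le (R : ℝ) : ∃ C, ∀ z, d.toFun z 0 < R → ‖z‖ ≤ C := by
  obtain ⟨m, hm, h⟩ := d.exists_norm_lt one_pos
  by_cases hR : 0 < R
  · refine ⟨‖(dilation (R / m) : G →L[ℝ] G)‖, fun z hz => ?_⟩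
    have hRm : 0 < R / m := div_pos hR hm
    have h1 : ‖dilation (R / m)⁻¹ z‖ < 1 := by
      refine h _ ?_
      rw [d.dilation_zero_right (inv_pos.2 hRm), inv_div, div_mul_eq_mul_div, div_lt_iff₀ hR]
      nlinarith
    calc ‖z‖ = ‖dilation (R / m) (dilation (R / m)⁻¹ z)‖ := by
          rw [dilation_dilation_inv hRm.ne']
      _ ≤ ‖(dilation (R / m) : G →L[ℝ] G)‖ * ‖dilation (R / m)⁻¹ z‖ :=
          ContinuousLinearMap.le_opNorm _ _
      _ ≤ ‖(dilation (R / m) : G →L[ℝ] G)‖ :=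
          mul_le_of_le_one_right (norm_nonneg _) h1.le
  · exact ⟨0, fun z hz => absurd (hz.trans_le (not_lt.1 hR)) (d.nonneg z 0).not_gt⟩

variable [MeasurableSpace G] [BorelSpace G]

theorem measure_ball (μ : Measure G) [μ.IsHaarMeasure] (x : G) {r : ℝ} (hr : 0 < r) :
    μ (d.ball x r) = ENNReal.ofReal (r ^ homDim G) * μ (d.ball 0 1) := by
  rw [d.ball_eq_image x hr, Set.image_mul_left, measure_preimage_mul,
    measure_image_dilation μ hr]

theorem measure_ball_lt_top (μ : Measure G) [μ.IsHaarMeasure] (x : G) (r : ℝ) :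
    μ (d.ball x r) < ⊤ := by
  by_cases hr : 0 < r
  · rw [d.measure_ball μ x hr]
    refine ENNReal.mul_lt_top ENNReal.ofReal_lt_top ?_
    obtain ⟨C, hC⟩ := d.exists_norm_le 1
    refine (measure_mono fun z hz => ?_).trans_lt
      (isCompact_closedBall (0 : G) C).measure_lt_top
    simpa using hC z hz
  · have : d.ball x r = ∅ := Set.eq_empty_of_forall_notMem fun y hy =>
      hr ((d.nonneg y x).trans_lt hy)
    simp [this]

end HomogeneousDistance

/-! ### Finite covers obtained from the spherical measure. -/

section Covering

variable {G : Type*} [NormedAddCommGroup G] [InnerProductSpace ℝ G] [FiniteDimensional ℝ G]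
  [StratifiedGroup G]

/-- Discard the balls that miss `K` and extract a finite subcover: the sum only decreases, and every
remaining centre is close to `K`, so the balls enlarged by the factor `R` stay in `U`. -/
theorem HomogeneousDistance.exists_finite_cover (d : HomogeneousDistance G) {α : ℝ} {K U : Set G}
    (hK : IsCompact K) (hU : IsOpen U) (hKU : K ⊆ U) {M : ℝ≥0∞} (hM : d.spherical α K < M)
    {R δ : ℝ} (hR : 0 < R) (hδ : 0 < δ) :
    ∃ (t : Finset ℕ) (x : ℕ → G) (r : ℕ → ℝ), (∀ j ∈ t, 0 < r j ∧ r j < δ) ∧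
      (∀ j ∈ t, ∀ y, d.toFun y (x j) ≤ R * r j → y ∈ U) ∧ (K ⊆ ⋃ j ∈ t, d.ball (x j) (r j)) ∧
      ∑ j ∈ t, ENNReal.ofReal (r j ^ α) ≤ M := by
  classical
  obtain ⟨V, hV, hKV⟩ := compact_open_separated_mul_right hK hU hKU
  rw [one_eq_zero] at hV
  obtain ⟨δ₀, hδ₀, hδ₀V⟩ := d.exists_forall_mem_of_mem_nhds hV
  -- A point within `R r` of a centre is within `(R + 1) r` of a point of `K`.
  have hδ' : 0 < min δ (δ₀ / (R + 1)) := lt_min hδ (by positivity)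
  have h : d.sphericalPre α (min δ (δ₀ / (R + 1))) K < M :=
    lt_of_le_of_lt (le_iSup₂ (f := fun δ (_ : 0 < δ) => d.sphericalPre α δ K) _ hδ') hM
  simp only [sphericalPre, iInf_lt_iff] at h
  obtain ⟨J, x, r, hr, hcov, hsum⟩ := h
  obtain ⟨b, hbJ, hbfin, hbcov⟩ := hK.elim_finite_subcover_image
    (b := {j | j ∈ J ∧ (d.ball (x j) (r j) ∩ K).Nonempty}) (c := fun j => d.ball (x j) (r j))
    (fun j _ => d.isOpen_ball _ _) (by
      intro k hk
      obtain ⟨j, hj, hkj⟩ := Set.mem_iUnion₂.1 (hcov hk)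
      exact Set.mem_iUnion₂.2 ⟨j, ⟨hj, k, hkj, hk⟩, hkj⟩)
  have hrδ : ∀ j ∈ b, 0 < r j ∧ r j < min δ (δ₀ / (R + 1)) := fun j hj =>
    ⟨(hr j (hbJ hj).1).1, by linarith [(hr j (hbJ hj).1).1, (hr j (hbJ hj).1).2]⟩
  refine ⟨hbfin.toFinset, x, r, fun j hj => ?_, fun j hj y hy => ?_, ?_, ?_⟩
  · have := hrδ j (hbfin.mem_toFinset.1 hj)
    exact ⟨this.1, this.2.trans_le (min_le_left _ _)⟩
  · have hjb := hbfin.mem_toFinset.1 hj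
    obtain ⟨k, hkj, hk⟩ := (hbJ hjb).2
    have hkj' : d.toFun k (x j) < r j := hkj
    refine hKV ⟨k, hk, k⁻¹ * y, hδ₀V _ ?_, mul_inv_cancel_left k y⟩
    rw [← d.eq_inv_mul]
    have h1 := d.triangle y (x j) k
    rw [d.symm (x j) k] at h1
    have h2 := (hrδ j hjb).2.trans_le (min_le_right _ _)
    rw [lt_div_iff₀ (by positivity)] at h2
    nlinarith
  · simpa using hbcov
  · refine le_trans ?_ hsum.le
    rw [tsum_subtype J fun j => ENNReal.ofReal (r j ^ α)]
    refine le_trans (Finset.sum_le_sum fun j hj => ?_) (ENNReal.sum_le_tsum hbfin.toFinset)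
    rw [Set.indicator_of_mem (hbJ (hbfin.mem_toFinset.1 hj)).1]

/-- For balls of radius at most `ε ^ (1 / q)` one has `r ^ Q ≤ ε r ^ (Q - q)`, so the total measure
of a cover is at most `ε` times a fixed constant. -/
theorem HomogeneousDistance.measure_eq_zero_of_spherical_lt_top [MeasurableSpace G] [BorelSpace G]
    (d : HomogeneousDistance G) (μ : Measure G) [μ.IsHaarMeasure] {q : ℝ} (hq : 0 < q) {K : Set G}
    (hK : IsCompact K) (h : d.spherical (homDim G - q) K < ⊤) : μ K = 0 := by
  set M := d.spherical (homDim G - q) K + 1 with hMdef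
  have hM : d.spherical (homDim G - q) K < M := ENNReal.lt_add_right h.ne one_ne_zero
  have hMtop : M ≠ ⊤ := by simp [M, h.ne]
  have key : ∀ ε : ℝ, 0 < ε → μ K ≤ ENNReal.ofReal ε * (M * μ (d.ball 0 1)) := by
    intro ε hε
    obtain ⟨t, x, r, hr, -, hcov, hsum⟩ := d.exists_finite_cover hK isOpen_univ
      (Set.subset_univ K) hM one_pos (Real.rpow_pos_of_pos hε q⁻¹)
    calc μ K ≤ ∑ j ∈ t, μ (d.ball (x j) (r j)) :=
          (measure_mono hcov).trans (measure_biUnion_finset_le _ _)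
      _ ≤ ∑ j ∈ t, ENNReal.ofReal ε * (ENNReal.ofReal (r j ^ (homDim G - q)) *
            μ (d.ball 0 1)) := by
          refine Finset.sum_le_sum fun j hj => ?_
          obtain ⟨h0, h1⟩ := hr j hj
          rw [d.measure_ball μ (x j) h0, ← mul_assoc, ← ENNReal.ofReal_mul hε.le]
          gcongr
          rw [Real.rpow_sub h0, Real.rpow_natCast, mul_div_assoc', le_div_iff₀ (by positivity),
            mul_comm ε]
          gcongr
          calc r j ^ q ≤ (ε ^ q⁻¹) ^ q := by gcongr
            _ = ε := Real.rpow_inv_rpow hε.le hq.ne'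
      _ = ENNReal.ofReal ε * ((∑ j ∈ t, ENNReal.ofReal (r j ^ (homDim G - q))) *
            μ (d.ball 0 1)) := by rw [Finset.sum_mul, Finset.mul_sum]
      _ ≤ ENNReal.ofReal ε * (M * μ (d.ball 0 1)) := by gcongr
  have hc : M * μ (d.ball 0 1) ≠ ⊤ := ENNReal.mul_ne_top hMtop (d.measure_ball_lt_top μ 0 1).ne
  have hlim : Tendsto (fun ε : ℝ => ENNReal.ofReal ε * (M * μ (d.ball 0 1))) (𝓝[>] 0) (𝓝 0) := by
    have h1 : Tendsto (fun ε : ℝ => ENNReal.ofReal ε) (𝓝[>] 0) (𝓝 0) := by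
      simpa using (ENNReal.continuous_ofReal.tendsto 0).mono_left nhdsWithin_le_nhds
    simpa using ENNReal.Tendsto.mul_const h1 (Or.inr hc)
  refine le_antisymm (ge_of_tendsto hlim ?_) bot_le
  filter_upwards [self_mem_nhdsWithin] with ε hε using key ε hε

end Covering

/-! ### Left-invariant derivatives and the horizontal gradient. -/

section HorizontalDerivative

variable {G : Type*} [NormedAddCommGroup G] [InnerProductSpace ℝ G] [StratifiedGroup G]

theorem leftInvDeriv_comp_mul (v : G) (f : G → ℝ) (z x : G) :
    leftInvDeriv v (fun y => f (z * y)) x = leftInvDeriv v f (z * x) := by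
  simp only [leftInvDeriv, mul_assoc]

variable [FiniteDimensional ℝ G]

theorem hasDerivAt_mul_smul (v x : G) :
    HasDerivAt (fun t : ℝ => x * (t • v)) (fderiv ℝ (fun z : G => x * z) 0 v) 0 := by
  have h1 : HasDerivAt (fun t : ℝ => t • v) v 0 := by
    simpa using (hasDerivAt_id (0 : ℝ)).smul_const v
  have h2 : HasFDerivAt (fun z : G => x * z) (fderiv ℝ (fun z : G => x * z) 0) ((0 : ℝ) • v) := by
    rw [zero_smul]
    exact ((contDiff_mul_left x).differentiable (by simp) _).hasFDerivAt
  exact h2.comp_hasDerivAt 0 h1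

theorem hasDerivAt_comp_mul_smul {f : G → ℝ} (hf : Differentiable ℝ f) (v x : G) :
    HasDerivAt (fun t : ℝ => f (x * (t • v)))
      (fderiv ℝ f x (fderiv ℝ (fun z : G => x * z) 0 v)) 0 := by
  have h : HasFDerivAt f (fderiv ℝ f x) (x * ((0 : ℝ) • v)) := by
    rw [zero_smul, mul_zero_eq]
    exact (hf x).hasFDerivAt
  exact h.comp_hasDerivAt 0 (hasDerivAt_mul_smul v x)

theorem leftInvDeriv_eq_fderiv {f : G → ℝ} (hf : Differentiable ℝ f) (v x : G) :
    leftInvDeriv v f x = fderiv ℝ f x (fderiv ℝ (fun z : G => x * z) 0 v) :=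
  (hasDerivAt_comp_mul_smul hf v x).deriv

theorem hasDerivAt_leftInvDeriv {f : G → ℝ} (hf : Differentiable ℝ f) (v x : G) :
    HasDerivAt (fun t : ℝ => f (x * (t • v))) (leftInvDeriv v f x) 0 := by
  rw [leftInvDeriv_eq_fderiv hf]
  exact hasDerivAt_comp_mul_smul hf v x

theorem continuous_leftInvDeriv {f : G → ℝ} (hf : ContDiff ℝ ∞ f) (v : G) :
    Continuous (leftInvDeriv v f) := by
  have : leftInvDeriv v f = fun x => fderiv ℝ f x (fderiv ℝ (fun z : G => x * z) 0 v) :=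
    funext fun x => leftInvDeriv_eq_fderiv (hf.differentiable (by simp)) v x
  rw [this]
  refine (hf.continuous_fderiv (by simp)).clm_apply (Continuous.clm_apply ?_ continuous_const)
  exact continuous_fderiv_mul_left.comp (continuous_id.prodMk continuous_const)

theorem leftInvDeriv_eq_zero_of_notMem {f : G → ℝ} (hf : Differentiable ℝ f) (v : G) {x : G}
    (hx : x ∉ tsupport f) : leftInvDeriv v f x = 0 := by
  rw [leftInvDeriv_eq_fderiv hf, fderiv_of_notMem_tsupport ℝ hx]
  rfl

/-- Dilations are homomorphisms acting on `V₁` as multiplication by `r`. This degree-one homogeneity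
is what makes bumps rescaled to radius `r` have horizontal derivatives of order `1 / r`. -/
theorem leftInvDeriv_comp_dilation {v : G} (hv : v ∈ layer (G := G) 1) (f : G → ℝ) (r : ℝ)
    (x : G) : leftInvDeriv v (fun y => f (dilation r y)) x =
      r * leftInvDeriv v f (dilation r x) := by
  have h := deriv_comp_mul_left r (fun t : ℝ => f (dilation r x * (t • v))) 0
  simp only [mul_zero, smul_eq_mul] at h
  rw [leftInvDeriv, leftInvDeriv, ← h]
  congr 1
  funext t
  rw [dilation_mul, map_smul, dilation_apply_of_mem r hv, pow_one, smul_smul, mul_comm]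

theorem norm_horizontalGradient_le (f : G → ℝ) (x : G) : ‖horizontalGradient f x‖ ≤
    ∑ j, |leftInvDeriv ((stdOrthonormalBasis ℝ (layer (G := G) 1) j : layer (G := G) 1) : G)
      f x| := by
  refine (norm_sum_le _ _).trans (Finset.sum_le_sum fun j _ => ?_)
  rw [norm_smul, (stdOrthonormalBasis ℝ (layer (G := G) 1)).orthonormal.1 j, mul_one,
    Real.norm_eq_abs]

theorem continuous_horizontalGradient {f : G → ℝ} (hf : ContDiff ℝ ∞ f) :
    Continuous (horizontalGradient f) :=
  continuous_finsetSum _ fun _ _ => (continuous_leftInvDeriv hf _).smul continuous_const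

theorem horizontalGradient_eq_zero_of_notMem {f : G → ℝ} (hf : Differentiable ℝ f) {x : G}
    (hx : x ∉ tsupport f) : horizontalGradient f x = 0 :=
  Finset.sum_eq_zero fun _ _ => by rw [leftInvDeriv_eq_zero_of_notMem hf _ hx, zero_smul]

theorem leftInvDeriv_comp_sum_pow {ι : Type*} (t : Finset ι) {H : ℝ → ℝ} (hH : Differentiable ℝ H)
    {g : ι → G → ℝ} (hg : ∀ j, Differentiable ℝ (g j)) (N : ℕ) (v x : G) :
    leftInvDeriv v (fun y => H (∑ j ∈ t, g j y ^ (N + 1))) x =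
      deriv H (∑ j ∈ t, g j x ^ (N + 1)) *
        ∑ j ∈ t, (N + 1) * (g j x ^ N * leftInvDeriv v (g j) x) := by
  have h1 : HasDerivAt (fun s : ℝ => ∑ j ∈ t, g j (x * (s • v)) ^ (N + 1))
      (∑ j ∈ t, (N + 1) * (g j x ^ N * leftInvDeriv v (g j) x)) 0 := by
    refine HasDerivAt.fun_sum fun j _ => ?_
    have := (hasDerivAt_leftInvDeriv (hg j) v x).fun_pow (N + 1)
    simpa [mul_zero_eq, mul_assoc] using this
  have h2 : HasDerivAt H (deriv H (∑ j ∈ t, g j x ^ (N + 1)))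
      (∑ j ∈ t, g j (x * ((0 : ℝ) • v)) ^ (N + 1)) := by
    rw [zero_smul, mul_zero_eq]
    exact (hH _).hasDerivAt
  exact (h2.comp 0 h1).deriv

end HorizontalDerivative

end StratifiedGroup

/-- Hölder's inequality with weights `η_j ^ (N + 1)`, of total mass at most `1`, applied to `c_j /
η_j`. The factor left over is `η_j ^ (N + 1 - q) ≤ 1`. -/
theorem Real.sum_pow_mul_rpow_le {ι : Type*} (t : Finset ι) {q : ℝ} (hq : 1 ≤ q) {N : ℕ}
    (hN : q ≤ N) {η c : ι → ℝ} (hη : ∀ j, 0 ≤ η j) (hη1 : ∀ j, η j ≤ 1) (hc : ∀ j, 0 ≤ c j)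
    (hsum : ∑ j ∈ t, η j ^ (N + 1) ≤ 1) :
    (∑ j ∈ t, η j ^ N * c j) ^ q ≤ ∑ j ∈ t, c j ^ q := by
  have hq0 : 0 < q := one_pos.trans_le hq
  have hN1 : N ≠ 0 := by
    rintro rfl
    simp only [Nat.cast_zero] at hN
    linarith
  have hpos : ∀ j, 0 ≤ η j ^ (N + 1) * ((η j)⁻¹ * c j) ^ q := fun j =>
    mul_nonneg (pow_nonneg (hη j) _)
      (Real.rpow_nonneg (mul_nonneg (inv_nonneg.2 (hη j)) (hc j)) _)
  have h1 := Real.inner_le_weight_mul_Lp_of_nonneg t hq (fun j => η j ^ (N + 1))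
    (fun j => (η j)⁻¹ * c j) (fun j => pow_nonneg (hη j) _)
    (fun j => mul_nonneg (inv_nonneg.2 (hη j)) (hc j))
  -- At `η j = 0` both sides vanish because `N ≠ 0`.
  have h2 : ∀ j, η j ^ (N + 1) * ((η j)⁻¹ * c j) = η j ^ N * c j := by
    intro j
    rcases (hη j).eq_or_lt with h | h
    · simp [← h, hN1]
    · field_simp
      ring
  simp only [h2] at h1
  have h3 : (∑ j ∈ t, η j ^ (N + 1)) ^ (1 - q⁻¹) ≤ 1 :=
    Real.rpow_le_one (Finset.sum_nonneg fun j _ => pow_nonneg (hη j) _) hsum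
      (sub_nonneg.2 (inv_le_one_of_one_le₀ hq))
  have hS : 0 ≤ ∑ j ∈ t, η j ^ (N + 1) * ((η j)⁻¹ * c j) ^ q := Finset.sum_nonneg fun j _ => hpos j
  have h4 : ∑ j ∈ t, η j ^ N * c j ≤ (∑ j ∈ t, η j ^ (N + 1) * ((η j)⁻¹ * c j) ^ q) ^ q⁻¹ :=
    h1.trans (mul_le_of_le_one_left (Real.rpow_nonneg hS _) h3)
  calc (∑ j ∈ t, η j ^ N * c j) ^ q
      ≤ ((∑ j ∈ t, η j ^ (N + 1) * ((η j)⁻¹ * c j) ^ q) ^ q⁻¹) ^ q :=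
        Real.rpow_le_rpow (Finset.sum_nonneg fun j _ => mul_nonneg (pow_nonneg (hη j) _) (hc j))
          h4 hq0.le
    _ = ∑ j ∈ t, η j ^ (N + 1) * ((η j)⁻¹ * c j) ^ q := Real.rpow_inv_rpow hS hq0.ne'
    _ ≤ ∑ j ∈ t, c j ^ q := by
        refine Finset.sum_le_sum fun j _ => ?_
        rcases (hη j).eq_or_lt with h | h
        · simpa [← h] using Real.rpow_nonneg (hc j) q
        · rw [Real.mul_rpow (inv_nonneg.2 h.le) (hc j), ← mul_assoc]
          refine mul_le_of_le_one_left (Real.rpow_nonneg (hc j) q) ?_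
          rw [Real.inv_rpow h.le, ← div_eq_mul_inv, div_le_one (Real.rpow_pos_of_pos h q),
            ← Real.rpow_natCast]
          refine Real.rpow_le_rpow_of_exponent_ge h (hη1 j) ?_
          push_cast
          linarith

/-- A smooth step from `0` to `1` with bounded derivative, locally constant after `1`. -/
theorem Real.exists_smooth_step : ∃ (H : ℝ → ℝ) (L : ℝ), ContDiff ℝ ∞ H ∧ 0 ≤ L ∧ H 0 = 0 ∧
    (∀ t, 0 ≤ H t ∧ H t ≤ 1) ∧ (∀ t, 1 ≤ t → H t = 1) ∧ (∀ t, 1 < t → deriv H t = 0) ∧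
    ∀ t, 0 ≤ t → t ≤ 1 → |deriv H t| ≤ L := by
  have hd : Continuous (deriv Real.smoothTransition) :=
    (Real.smoothTransition.contDiff (n := 1)).continuous_deriv (by simp)
  obtain ⟨L, hL⟩ := (isCompact_Icc (a := (0 : ℝ)) (b := 1)).exists_bound_of_continuousOn
    hd.continuousOn
  refine ⟨Real.smoothTransition, L, Real.smoothTransition.contDiff,
    (norm_nonneg _).trans (hL 0 (by simp)), Real.smoothTransition.zero,
    fun t => ⟨Real.smoothTransition.nonneg t, Real.smoothTransition.le_one t⟩,
    fun t => Real.smoothTransition.one_of_one_le, fun t ht => ?_, fun t h0 h1 => hL t ⟨h0, h1⟩⟩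
  have : Real.smoothTransition =ᶠ[nhds t] fun _ => 1 := by
    filter_upwards [lt_mem_nhds ht] with s hs using Real.smoothTransition.one_of_one_le hs.le
  rw [this.deriv_eq, deriv_const]

namespace StratifiedGroup

open StratifiedLieAlgebra Filter Topology

/-! ### Cutoffs and the capacity estimate. -/

section TestFunction

variable {G : Type*} [NormedAddCommGroup G] [InnerProductSpace ℝ G] [FiniteDimensional ℝ G]
  [StratifiedGroup G] (d : HomogeneousDistance G)

/-- Smooth cutoff functions adapted to balls, with horizontal derivatives inversely proportional
to the radius. -/
theorem HomogeneousDistance.exists_cutoff : ∃ R L : ℝ, 0 < R ∧ 0 ≤ L ∧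
    ∀ (a : G) (r : ℝ), 0 < r → ∃ η : G → ℝ, ContDiff ℝ ∞ η ∧ (∀ y, 0 ≤ η y ∧ η y ≤ 1) ∧
      (∀ y ∈ d.ball a r, η y = 1) ∧ (∀ y, η y ≠ 0 → d.toFun y a ≤ R * r) ∧
      ∀ j y, |leftInvDeriv ((stdOrthonormalBasis ℝ (layer (G := G) 1) j : layer (G := G) 1) : G) η y|
        ≤ (d.ball a (R * r)).indicator (fun _ => L / r) y := by
  obtain ⟨C, hC⟩ := d.exists_norm_le 1
  -- A Euclidean bump equal to `1` on the unit `d`-ball; every other cutoff is a translate of a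
  -- dilate of it.
  let b : ContDiffBump (0 : G) := ⟨|C| + 1, |C| + 2, by positivity, by linarith⟩
  have hb : ContDiff ℝ ∞ (b : G → ℝ) := b.contDiff
  have hbd : Differentiable ℝ (b : G → ℝ) := hb.differentiable (by simp)
  obtain ⟨R₀, hR₀⟩ := b.hasCompactSupport.isCompact.exists_bound_of_continuousOn
    (d.continuous_left 0).continuousOn
  let e := fun j => ((stdOrthonormalBasis ℝ (layer (G := G) 1) j : layer (G := G) 1) : G)
  have hL : ∀ j, ∃ L, ∀ y, |leftInvDeriv (e j) b y| ≤ L := by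
    intro j
    obtain ⟨L, hL⟩ := b.hasCompactSupport.isCompact.exists_bound_of_continuousOn
      (continuous_leftInvDeriv hb (e j)).continuousOn
    refine ⟨max L 0, fun y => ?_⟩
    by_cases hy : y ∈ tsupport (b : G → ℝ)
    · exact (hL y hy).trans (le_max_left _ _)
    · rw [leftInvDeriv_eq_zero_of_notMem hbd _ hy, abs_zero]
      exact le_max_right _ _
  choose L hL using hL
  have hL0 : ∀ j, 0 ≤ L j := fun j => (abs_nonneg _).trans (hL j 0)
  refine ⟨|R₀| + 1, ∑ j, L j, by positivity, Finset.sum_nonneg fun j _ => hL0 j, ?_⟩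
  intro a r hr
  have hdist : ∀ y, d.toFun (dilation r⁻¹ (a⁻¹ * y)) 0 = r⁻¹ * d.toFun y a := fun y => by
    rw [d.dilation_zero_right (inv_pos.2 hr), ← d.eq_inv_mul]
  have hsupp : ∀ y, dilation r⁻¹ (a⁻¹ * y) ∈ tsupport (b : G → ℝ) →
      d.toFun y a < (|R₀| + 1) * r := by
    intro y hy
    have h1 := hR₀ _ hy
    rw [hdist, Real.norm_eq_abs] at h1
    have h2 : r⁻¹ * d.toFun y a < |R₀| + 1 := by
      linarith [le_abs_self (r⁻¹ * d.toFun y a), le_abs_self R₀]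
    rwa [inv_mul_lt_iff₀ hr, mul_comm] at h2
  refine ⟨fun y => b (dilation r⁻¹ (a⁻¹ * y)), ?_, fun y => ⟨b.nonneg, b.le_one⟩, ?_, ?_, ?_⟩
  · exact hb.comp ((dilation r⁻¹ : G →L[ℝ] G).contDiff.comp (contDiff_mul_left a⁻¹))
  · intro y hy
    refine b.one_of_mem_closedBall ?_
    have h1 := hC (dilation r⁻¹ (a⁻¹ * y)) (by
      rw [hdist, inv_mul_lt_iff₀ hr, mul_one]
      exact hy)
    rw [mem_closedBall_zero_iff]
    change _ ≤ |C| + 1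
    linarith [le_abs_self C]
  · exact fun y hy => (hsupp y (subset_tsupport _ hy)).le
  · intro j y
    have h1 : leftInvDeriv (e j) (fun y => b (dilation r⁻¹ (a⁻¹ * y))) y =
        r⁻¹ * leftInvDeriv (e j) b (dilation r⁻¹ (a⁻¹ * y)) := by
      rw [leftInvDeriv_comp_mul (e j) (fun z => b (dilation r⁻¹ z)),
        leftInvDeriv_comp_dilation (Subtype.property _)]
    change |leftInvDeriv (e j) (fun y => b (dilation r⁻¹ (a⁻¹ * y))) y| ≤ _
    rw [h1]
    by_cases hy : dilation r⁻¹ (a⁻¹ * y) ∈ tsupport (b : G → ℝ)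
    · rw [Set.indicator_of_mem (show y ∈ d.ball a _ from hsupp y hy), abs_mul,
        abs_of_pos (inv_pos.2 hr), mul_comm, ← div_eq_mul_inv]
      gcongr
      exact (hL j _).trans (Finset.single_le_sum (fun j _ => hL0 j) (Finset.mem_univ j))
    · rw [leftInvDeriv_eq_zero_of_notMem hbd _ hy, mul_zero, abs_zero]
      exact Set.indicator_nonneg (fun _ _ =>
        div_nonneg (Finset.sum_nonneg fun j _ => hL0 j) hr.le) _

/-- Test functions equal to `1` on the union of finitely many balls, whose horizontal gradient is
controlled by the `ℓ^q` sum of the inverse radii of the overlapping balls. -/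
theorem HomogeneousDistance.exists_union_cutoff {q : ℝ} (hq : 1 ≤ q) : ∃ R C : ℝ, 0 < R ∧ 0 ≤ C ∧
    ∀ (t : Finset ℕ) (a : ℕ → G) (r : ℕ → ℝ), (∀ j ∈ t, 0 < r j) →
      ∃ φ : G → ℝ, ContDiff ℝ ∞ φ ∧ (∀ y, 0 ≤ φ y ∧ φ y ≤ 1) ∧
        (∀ y ∈ ⋃ j ∈ t, d.ball (a j) (r j), φ y = 1) ∧
        (∀ y, φ y ≠ 0 → ∃ j ∈ t, d.toFun y (a j) ≤ R * r j) ∧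
        ∀ y, ‖horizontalGradient φ y‖ ^ q ≤
          C * ∑ j ∈ t, (d.ball (a j) (R * r j)).indicator (fun _ => (r j)⁻¹ ^ q) y := by
  obtain ⟨R, L, hR, hL, hcut⟩ := d.exists_cutoff
  obtain ⟨H, L', hH, hL', hH0, hH01, hH1, hdH0, hdH⟩ := Real.exists_smooth_step
  have hq0 : 0 < q := one_pos.trans_le hq
  let N := ⌈q⌉₊
  have hN : q ≤ N := Nat.le_ceil q
  let m : ℝ := Fintype.card (Fin (Module.finrank ℝ (layer (G := G) 1)))
  have hm : 0 ≤ m := Nat.cast_nonneg _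
  let A : ℝ := m * (L' * ((N + 1) * L))
  have hA : 0 ≤ A := by positivity
  refine ⟨R, A ^ q, hR, by positivity, fun t a r hr => ?_⟩
  have hr' : ∀ j, ∃ η : G → ℝ, ContDiff ℝ ∞ η ∧ (∀ y, 0 ≤ η y ∧ η y ≤ 1) ∧
      (j ∈ t → (∀ y ∈ d.ball (a j) (r j), η y = 1) ∧ (∀ y, η y ≠ 0 → d.toFun y (a j) ≤ R * r j) ∧
      ∀ i y, |leftInvDeriv ((stdOrthonormalBasis ℝ (layer (G := G) 1) i : layer (G := G) 1) : G) η y|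
        ≤ (d.ball (a j) (R * r j)).indicator (fun _ => L / r j) y) := by
    intro j
    by_cases hj : j ∈ t
    · obtain ⟨η, h1, h2, h3, h4, h5⟩ := hcut (a j) (r j) (hr j hj)
      exact ⟨η, h1, h2, fun _ => ⟨h3, h4, h5⟩⟩
    · exact ⟨fun _ => 0, contDiff_const, by simp, fun h => absurd h hj⟩
  choose η hη hη01 hηt using hr'
  have hηd : ∀ j, Differentiable ℝ (η j) := fun j => (hη j).differentiable (by simp)
  have hS0 : ∀ y, 0 ≤ ∑ j ∈ t, η j y ^ (N + 1) := fun y =>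
    Finset.sum_nonneg fun j _ => pow_nonneg (hη01 j y).1 _
  -- A smooth substitute for `max_j η_j`. Differentiating the powers leaves weights `η_j ^ N`, as
  -- the weighted inequality requires.
  refine ⟨fun y => H (∑ j ∈ t, η j y ^ (N + 1)), ?_, fun y => hH01 _, fun y hy => ?_,
    fun y hy => ?_, fun y => ?_⟩
  · exact hH.comp (ContDiff.sum fun j _ => (hη j).pow _)
  · obtain ⟨j, hj, hyj⟩ := Set.mem_iUnion₂.1 hy
    refine hH1 _ ?_
    have := Finset.single_le_sum (f := fun j => η j y ^ (N + 1))
      (fun i _ => pow_nonneg (hη01 i y).1 _) hj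
    simpa [(hηt j hj).1 y hyj] using this
  · by_contra! hcon
    refine hy ((congrArg H (Finset.sum_eq_zero fun j hj => ?_)).trans hH0)
    have : η j y = 0 := by
      by_contra hne
      exact (hcon j hj).not_ge ((hηt j hj).2.1 y hne)
    simp [this]
  · set c : ℕ → ℝ := fun j => if j ∈ t then
      (d.ball (a j) (R * r j)).indicator (fun _ => (r j)⁻¹) y else 0 with hc
    have hc0 : ∀ j, 0 ≤ c j := by
      intro j
      by_cases hj : j ∈ t
      · simp only [hc, if_pos hj]
        exact Set.indicator_nonneg (fun _ _ => (inv_pos.2 (hr j hj)).le) _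
      · simp [hc, hj]
    have hcq : ∑ j ∈ t, c j ^ q =
        ∑ j ∈ t, (d.ball (a j) (R * r j)).indicator (fun _ => (r j)⁻¹ ^ q) y := by
      refine Finset.sum_congr rfl fun j hj => ?_
      by_cases hy : y ∈ d.ball (a j) (R * r j)
      · simp [hc, hj, hy]
      · simp [hc, hj, hy, hq0.ne']
    have hcq0 : 0 ≤ ∑ j ∈ t, c j ^ q := Finset.sum_nonneg fun j _ => Real.rpow_nonneg (hc0 j) q
    have hbound : ‖horizontalGradient (fun y => H (∑ j ∈ t, η j y ^ (N + 1))) y‖ ≤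
        A * (∑ j ∈ t, c j ^ q) ^ q⁻¹ := by
      have hi : ∀ i, |leftInvDeriv
          ((stdOrthonormalBasis ℝ (layer (G := G) 1) i : layer (G := G) 1) : G)
          (fun y => H (∑ j ∈ t, η j y ^ (N + 1))) y| ≤
          (L' * ((N + 1) * L)) * (∑ j ∈ t, c j ^ q) ^ q⁻¹ := by
        intro i
        rw [leftInvDeriv_comp_sum_pow t (hH.differentiable (by simp)) hηd]
        -- Where the sum exceeds `1` the step function is locally constant; elsewhere the weights
        -- have mass at most `1` and the weighted inequality applies. No control of the overlap is
        -- needed.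
        by_cases hS : 1 < ∑ j ∈ t, η j y ^ (N + 1)
        · rw [hdH0 _ hS, zero_mul, abs_zero]
          positivity
        · rw [abs_mul, mul_assoc]
          refine mul_le_mul (hdH _ (hS0 y) (not_lt.1 hS)) ?_ (abs_nonneg _) hL'
          have h1 : ∑ j ∈ t, η j y ^ N * c j ≤ (∑ j ∈ t, c j ^ q) ^ q⁻¹ := by
            rw [Real.le_rpow_inv_iff_of_pos (Finset.sum_nonneg fun j _ =>
              mul_nonneg (pow_nonneg (hη01 j y).1 _) (hc0 j)) hcq0 hq0]
            exact Real.sum_pow_mul_rpow_le t hq hN (fun j => (hη01 j y).1)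
              (fun j => (hη01 j y).2) hc0 (not_lt.1 hS)
          refine le_trans ?_ (mul_le_mul_of_nonneg_left h1 (by positivity))
          refine (Finset.abs_sum_le_sum_abs _ _).trans ?_
          rw [Finset.mul_sum]
          refine Finset.sum_le_sum fun j hj => ?_
          have h2 := (hηt j hj).2.2 i y
          have h3 : (d.ball (a j) (R * r j)).indicator (fun _ => L / r j) y = L * c j := by
            by_cases hy : y ∈ d.ball (a j) (R * r j)
            · simp [hc, hj, hy, div_eq_mul_inv]
            · simp [hc, hj, hy]
          rw [h3] at h2
          rw [abs_mul, abs_mul, abs_of_nonneg (by positivity : (0 : ℝ) ≤ N + 1),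
            abs_of_nonneg (pow_nonneg (hη01 j y).1 N), mul_assoc, mul_left_comm L]
          gcongr
          exact pow_nonneg (hη01 j y).1 N
      refine (norm_horizontalGradient_le _ y).trans ?_
      refine (Finset.sum_le_sum fun i _ => hi i).trans ?_
      rw [Finset.sum_const, Finset.card_univ, nsmul_eq_mul, ← mul_assoc]
    rw [← hcq]
    calc _ ≤ (A * (∑ j ∈ t, c j ^ q) ^ q⁻¹) ^ q :=
          Real.rpow_le_rpow (norm_nonneg _) hbound hq0.le
      _ = A ^ q * ∑ j ∈ t, c j ^ q := by
          rw [Real.mul_rpow hA (by positivity), Real.rpow_inv_rpow hcq0 hq0.ne']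

/-- Compact sets of finite spherical measure of codimension `q` have finite `q`-capacity. -/
theorem HomogeneousDistance.exists_testFunction [MeasurableSpace G] [BorelSpace G]
    (μ : Measure G) [μ.IsHaarMeasure] {q : ℝ} (hq : 1 ≤ q) : ∃ C : ℝ≥0∞, C ≠ ⊤ ∧
    ∀ (K U : Set G) (M : ℝ≥0∞), IsCompact K → IsOpen U → K ⊆ U → IsCompact (closure U) →
      d.spherical (homDim G - q) K < M →
      ∃ φ : G → ℝ, ContDiff ℝ ∞ φ ∧ HasCompactSupport φ ∧ tsupport φ ⊆ U ∧
        (∀ y, 0 ≤ φ y ∧ φ y ≤ 1) ∧ (∀ y ∈ K, φ y = 1) ∧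
        ∫⁻ y, ENNReal.ofReal (‖horizontalGradient φ y‖ ^ q) ∂μ ≤ C * M := by
  obtain ⟨R, C, hR, hC, hcut⟩ := d.exists_union_cutoff hq
  refine ⟨ENNReal.ofReal C * (ENNReal.ofReal (R ^ homDim G) * μ (d.ball 0 1)),
    ENNReal.mul_ne_top ENNReal.ofReal_ne_top
      (ENNReal.mul_ne_top ENNReal.ofReal_ne_top (d.measure_ball_lt_top μ 0 1).ne), ?_⟩
  intro K U M hK hU hKU hUc hM
  obtain ⟨t, a, r, hr, hrU, hcov, hsum⟩ := d.exists_finite_cover hK hU hKU hM hR one_pos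
  obtain ⟨φ, hφ, hφ01, hφ1, hφ0, hgrad⟩ := hcut t a r fun j hj => (hr j hj).1
  have hclosed : IsClosed (⋃ j ∈ t, {y | d.toFun y (a j) ≤ R * r j}) :=
    t.finite_toSet.isClosed_biUnion fun j _ =>
      isClosed_le (d.continuous_left (a j)) continuous_const
  have htU : tsupport φ ⊆ U := by
    refine (closure_minimal (fun y hy => ?_) hclosed).trans (Set.iUnion₂_subset fun j hj y hy =>
      hrU j hj y hy)
    obtain ⟨j, hj, hy⟩ := hφ0 y hy
    exact Set.mem_iUnion₂.2 ⟨j, hj, hy⟩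
  refine ⟨φ, hφ, hUc.of_isClosed_subset (isClosed_tsupport φ) (htU.trans subset_closure), htU,
    hφ01, fun y hy => hφ1 y (hcov hy), ?_⟩
  have hterm : ∀ j ∈ t, ∀ y, 0 ≤ (d.ball (a j) (R * r j)).indicator (fun _ => (r j)⁻¹ ^ q) y :=
    fun j hj y => Set.indicator_nonneg (fun _ _ =>
      Real.rpow_nonneg (inv_pos.2 (hr j hj).1).le q) y
  calc ∫⁻ y, ENNReal.ofReal (‖horizontalGradient φ y‖ ^ q) ∂μ
      ≤ ∫⁻ y, ENNReal.ofReal C * ∑ j ∈ t, (d.ball (a j) (R * r j)).indicator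
          (fun _ => ENNReal.ofReal ((r j)⁻¹ ^ q)) y ∂μ := by
        refine lintegral_mono fun y => (ENNReal.ofReal_le_ofReal (hgrad y)).trans_eq ?_
        rw [ENNReal.ofReal_mul hC, ENNReal.ofReal_sum_of_nonneg fun j hj => hterm j hj y]
        congr 1
        refine Finset.sum_congr rfl fun j _ => ?_
        by_cases hy : y ∈ d.ball (a j) (R * r j) <;> simp [hy]
    _ = ENNReal.ofReal C * ∑ j ∈ t, ENNReal.ofReal ((r j)⁻¹ ^ q) *
          μ (d.ball (a j) (R * r j)) := by
        rw [lintegral_const_mul' _ _ ENNReal.ofReal_ne_top, lintegral_finsetSum]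
        · congr 1
          refine Finset.sum_congr rfl fun j _ => ?_
          rw [lintegral_indicator_const (d.isOpen_ball _ _).measurableSet]
        · exact fun j _ => measurable_const.indicator (d.isOpen_ball _ _).measurableSet
    -- Scaling of the measure of balls turns `r ^ (-q) μ(B(x, R r))` into a constant times `r ^ (Q -
    -- q)`.
    _ = ENNReal.ofReal C * ∑ j ∈ t, ENNReal.ofReal (R ^ homDim G) * μ (d.ball 0 1) *
          ENNReal.ofReal (r j ^ (homDim G - q)) := by
        congr 1
        refine Finset.sum_congr rfl fun j hj => ?_
        have h0 := (hr j hj).1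
        rw [d.measure_ball μ (a j) (mul_pos hR h0), Real.rpow_sub h0, Real.rpow_natCast, mul_pow,
          ENNReal.ofReal_mul (by positivity), Real.inv_rpow h0.le, div_eq_mul_inv,
          ENNReal.ofReal_mul (by positivity)]
        ring
    _ ≤ _ := by
        rw [← Finset.mul_sum, mul_assoc (ENNReal.ofReal C)]
        gcongr

end TestFunction

end StratifiedGroup

/-! ### Radon measures on an open set and smooth test functions. -/

section TestFunctions

open Filter Topology

theorem IsCompact.exists_subset_of_exhaustion {X : Type*} [TopologicalSpace X] {K : Set X}
    (hK : IsCompact K) {W : ℕ → Set X}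
    (hW : ∀ n, IsOpen (W n)) (hWm : Monotone W) (h : K ⊆ ⋃ n, W n) : ∃ n, K ⊆ W n :=
  hK.elim_directed_cover W hW h hWm.directed_le

section Space

variable {X : Type*} [NormedAddCommGroup X] [MeasurableSpace X] [BorelSpace X]

theorem Continuous.integrable_of_measure_tsupport_lt_top {f : X → ℝ} (hf : Continuous f)
    (hfc : HasCompactSupport f) {α : Measure X} (hα : α (tsupport f) < ⊤) : Integrable f α := by
  obtain ⟨C, hC⟩ := hf.bounded_above_of_compact_support hfc
  rw [← integrableOn_iff_integrable_of_support_subset (subset_tsupport f)]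
  exact Measure.integrableOn_of_bounded hα.ne hf.aestronglyMeasurable (ae_of_all _ hC)

theorem IsCompact.measure_le_ofReal_integral {K : Set X} (hK : IsCompact K) {α : Measure X}
    {φ : X → ℝ} (hφ : Integrable φ α) (h0 : ∀ x, 0 ≤ φ x) (h1 : ∀ x ∈ K, φ x = 1) :
    α K ≤ ENNReal.ofReal (∫ x, φ x ∂α) := by
  rw [ofReal_integral_eq_lintegral_ofReal hφ (ae_of_all _ h0), ← lintegral_indicator_one
    hK.measurableSet]
  refine lintegral_mono fun x => ?_
  by_cases hx : x ∈ K <;> simp [hx, h1]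

end Space

variable {E : Type*} [NormedAddCommGroup E] [NormedSpace ℝ E] [FiniteDimensional ℝ E]

theorem IsOpen.exists_exhaustion {Ω : Set E} (hΩ : IsOpen Ω) : ∃ W : ℕ → Set E,
    (∀ n, IsOpen (W n)) ∧ (∀ n, IsCompact (closure (W n))) ∧
    (∀ n, closure (W n) ⊆ W (n + 1)) ∧ ⋃ n, W n = Ω := by
  have : ProperSpace E := FiniteDimensional.proper ℝ E
  have := hΩ.locallyCompactSpace
  let k := CompactExhaustion.choice Ω
  have hcl : ∀ n, closure (Subtype.val '' interior (k n) : Set E) ⊆ Subtype.val '' (k n) :=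
    fun n => closure_minimal (Set.image_mono interior_subset)
      ((k.isCompact n).image continuous_subtype_val).isClosed
  refine ⟨fun n => Subtype.val '' interior (k n),
    fun n => hΩ.isOpenMap_subtype_val _ isOpen_interior,
    fun n => ((k.isCompact n).image continuous_subtype_val).of_isClosed_subset isClosed_closure
      (hcl n), fun n => (hcl n).trans (Set.image_mono (k.subset_interior_succ n)), ?_⟩
  rw [← Set.image_iUnion]
  have : ⋃ n, interior (k n) = Set.univ := by
    refine Set.eq_univ_of_univ_subset ?_
    rw [← k.iUnion_eq]
    refine Set.iUnion_subset fun n => (k.subset_interior_succ n).trans ?_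
    exact Set.subset_iUnion (fun n => interior (k n)) (n + 1)
  rw [this, Set.image_univ, Subtype.range_coe]

theorem IsCompact.exists_contDiff_cutoff {K U : Set E} (hK : IsCompact K) (hU : IsOpen U)
    (hKU : K ⊆ U) : ∃ φ : E → ℝ, ContDiff ℝ ∞ φ ∧ HasCompactSupport φ ∧ tsupport φ ⊆ U ∧
      (∀ x, 0 ≤ φ x ∧ φ x ≤ 1) ∧ ∀ x ∈ K, φ x = 1 := by
  have : ProperSpace E := FiniteDimensional.proper ℝ E
  obtain ⟨V, hV, hKV, hVU, hVc⟩ := exists_open_between_and_isCompact_closure hK hU hKU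
  obtain ⟨φ, hφ, hrange, hsupp, hone⟩ := exists_contMDiff_support_eq_eq_one_iff (n := ⊤)
    (modelWithCornersSelf ℝ E) hV hK.isClosed hKV
  have ht : tsupport φ = closure V := by rw [tsupport, hsupp]
  refine ⟨φ, hφ.contDiff, by rwa [HasCompactSupport, ht], ht ▸ hVU,
    fun x => hrange ⟨x, rfl⟩, fun x hx => (hone x).1 hx⟩

variable [MeasurableSpace E] [BorelSpace E]

/-- On each member of a relatively compact exhaustion `α` is finite, hence inner regular; `β` enters
only through monotonicity. -/
theorem MeasurableSet.measure_le_of_forall_isCompact {Ω : Set E} (hΩ : IsOpen Ω)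
    {α β : Measure E} (hα : ∀ K, IsCompact K → K ⊆ Ω → α K < ⊤) {T : Set E}
    (hT : MeasurableSet T) (hTΩ : T ⊆ Ω) (h : ∀ K, IsCompact K → K ⊆ T → α K ≤ β K) :
    α T ≤ β T := by
  have : ProperSpace E := FiniteDimensional.proper ℝ E
  obtain ⟨W, hW, hWc, hWs, hWu⟩ := hΩ.exists_exhaustion
  have hWm : Monotone W := monotone_nat_of_le_succ fun n => subset_closure.trans (hWs n)
  have hTU : T = ⋃ n, T ∩ W n := by
    rw [← Set.inter_iUnion, hWu, Set.inter_eq_left.2 hTΩ]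
  have hmono : Monotone fun n => T ∩ W n := fun _ _ hmn =>
    Set.inter_subset_inter_right T (hWm hmn)
  conv_lhs => rw [hTU, hmono.measure_iUnion]
  refine iSup_le fun n => ?_
  have hcl : closure (W n) ⊆ Ω := (hWs n).trans (hWu ▸ Set.subset_iUnion W (n + 1))
  have hfin : IsFiniteMeasure (α.restrict (W n)) := isFiniteMeasure_restrict.2
    ((measure_mono subset_closure).trans_lt (hα _ (hWc n) hcl)).ne
  have hTn : MeasurableSet (T ∩ W n) := hT.inter (hW n).measurableSet
  have h1 := hTn.measure_eq_iSup_isCompact_of_ne_top (μ := α.restrict (W n))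
    (measure_ne_top _ _)
  rw [Measure.restrict_apply hTn, Set.inter_assoc, Set.inter_self] at h1
  rw [h1]
  refine iSup_le fun K => iSup_le fun hKT => iSup_le fun hK => ?_
  calc α.restrict (W n) K ≤ α K := Measure.restrict_apply_le _ _
    _ ≤ β K := h K hK (hKT.trans Set.inter_subset_left)
    _ ≤ β T := measure_mono (hKT.trans Set.inter_subset_left)

/-- Outer regularity at compact sets of measures that are finite on the compact subsets of an
open set. -/
theorem IsCompact.exists_isOpen_measure_lt {Ω : Set E} (hΩ : IsOpen Ω) {β : Measure E}
    (hβ : ∀ K, IsCompact K → K ⊆ Ω → β K < ⊤) {K : Set E} (hK : IsCompact K) (hKΩ : K ⊆ Ω)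
    {r : ℝ≥0∞} (hr : β K < r) : ∃ U, IsOpen U ∧ K ⊆ U ∧ U ⊆ Ω ∧ β U < r := by
  have : ProperSpace E := FiniteDimensional.proper ℝ E
  obtain ⟨V, hV, hKV, hVΩ, hVc⟩ := exists_open_between_and_isCompact_closure hK hΩ hKΩ
  have hfin : IsFiniteMeasure (β.restrict V) := isFiniteMeasure_restrict.2
    ((measure_mono subset_closure).trans_lt (hβ _ hVc hVΩ)).ne
  obtain ⟨U, hKU, hU, hUr⟩ := K.exists_isOpen_lt_of_lt (μ := β.restrict V) r
    ((Measure.restrict_apply_le _ _).trans_lt hr)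
  refine ⟨U ∩ V, hU.inter hV, Set.subset_inter hKU hKV,
    Set.inter_subset_right.trans (subset_closure.trans hVΩ), ?_⟩
  rwa [← Measure.restrict_apply hU.measurableSet]

theorem measure_le_of_forall_testFunction {Ω : Set E} (hΩ : IsOpen Ω) {α β : Measure E}
    (hα : ∀ K, IsCompact K → K ⊆ Ω → α K < ⊤) (hβ : ∀ K, IsCompact K → K ⊆ Ω → β K < ⊤)
    (h : ∀ φ : E → ℝ, ContDiff ℝ ∞ φ → HasCompactSupport φ → tsupport φ ⊆ Ω →
      ∫ x, φ x ∂α = ∫ x, φ x ∂β) {T : Set E} (hT : MeasurableSet T) (hTΩ : T ⊆ Ω) :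
    α T ≤ β T := by
  refine hT.measure_le_of_forall_isCompact hΩ hα hTΩ fun K hK hKT => le_of_forall_gt fun r hr => ?_
  obtain ⟨U, hU, hKU, hUΩ, hUr⟩ := hK.exists_isOpen_measure_lt hΩ hβ (hKT.trans hTΩ) hr
  obtain ⟨φ, hφ, hφc, hφU, h01, h1⟩ := hK.exists_contDiff_cutoff hU hKU
  calc α K ≤ ENNReal.ofReal (∫ x, φ x ∂α) := hK.measure_le_ofReal_integral
        (hφ.continuous.integrable_of_measure_tsupport_lt_top hφc (hα _ hφc (hφU.trans hUΩ)))
        (fun x => (h01 x).1) h1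
    _ = ENNReal.ofReal (∫ x, φ x ∂β) := by rw [h φ hφ hφc (hφU.trans hUΩ)]
    _ ≤ β U := integral_le_measure (fun x _ => (h01 x).2) fun x hx =>
        (image_eq_zero_of_notMem_tsupport fun hx' => hx (hφU hx')).le
    _ < r := hUr

/-- Two measures on an open set, finite on its compact subsets, which agree on test functions are
equal. -/
theorem measure_eq_of_forall_testFunction {Ω : Set E} (hΩ : IsOpen Ω) {α β : Measure E}
    (hα : ∀ K, IsCompact K → K ⊆ Ω → α K < ⊤) (hβ : ∀ K, IsCompact K → K ⊆ Ω → β K < ⊤)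
    (h : ∀ φ : E → ℝ, ContDiff ℝ ∞ φ → HasCompactSupport φ → tsupport φ ⊆ Ω →
      ∫ x, φ x ∂α = ∫ x, φ x ∂β) {T : Set E} (hT : MeasurableSet T) (hTΩ : T ⊆ Ω) :
    α T = β T :=
  le_antisymm (measure_le_of_forall_testFunction hΩ hα hβ h hT hTΩ)
    (measure_le_of_forall_testFunction hΩ hβ hα (fun φ h1 h2 h3 => (h φ h1 h2 h3).symm) hT hTΩ)

/-- Since `β K = 0`, there is an open `U ⊇ K` with `β U ≤ ε / 2`. A cutoff supported in `U` then
gives `α K ≤ ∫ φ dα ≤ ε / 2 + ∫ φ dβ ≤ ε`. -/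
theorem IsCompact.measure_eq_zero_of_small_cutoffs {Ω : Set E} (hΩ : IsOpen Ω) {α β : Measure E}
    (hα : ∀ K, IsCompact K → K ⊆ Ω → α K < ⊤) (hβ : ∀ K, IsCompact K → K ⊆ Ω → β K < ⊤)
    {K : Set E} (hK : IsCompact K) (hKΩ : K ⊆ Ω) (hβK : β K = 0)
    (h : ∀ U, IsOpen U → K ⊆ U → U ⊆ Ω → ∀ ε : ℝ, 0 < ε → ∃ φ : E → ℝ, ContDiff ℝ ∞ φ ∧
      HasCompactSupport φ ∧ tsupport φ ⊆ U ∧ (∀ x, 0 ≤ φ x ∧ φ x ≤ 1) ∧ (∀ x ∈ K, φ x = 1) ∧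
      ∫ x, φ x ∂α - ∫ x, φ x ∂β ≤ ε) : α K = 0 := by
  refine le_antisymm (ENNReal.le_of_forall_pos_le_add fun ε hε _ => ?_) bot_le
  have hε2 : (0 : ℝ) < ε / 2 := by positivity
  obtain ⟨U, hU, hKU, hUΩ, hUε⟩ := hK.exists_isOpen_measure_lt hΩ hβ hKΩ
    (r := ENNReal.ofReal (ε / 2)) (by rw [hβK]; exact ENNReal.ofReal_pos.2 hε2)
  obtain ⟨φ, hφ, hφc, hφU, h01, h1, hint⟩ := h U hU hKU hUΩ _ hε2
  have h2 : ENNReal.ofReal (∫ x, φ x ∂β) ≤ ENNReal.ofReal (ε / 2) :=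
    (integral_le_measure (fun x _ => (h01 x).2) fun x hx =>
      (image_eq_zero_of_notMem_tsupport fun hx' => hx (hφU hx')).le).trans hUε.le
  rw [ENNReal.ofReal_le_ofReal_iff hε2.le] at h2
  calc α K ≤ ENNReal.ofReal (∫ x, φ x ∂α) := hK.measure_le_ofReal_integral
        (hφ.continuous.integrable_of_measure_tsupport_lt_top hφc (hα _ hφc (hφU.trans hUΩ)))
        (fun x => (h01 x).1) h1
    _ ≤ ENNReal.ofReal ε := ENNReal.ofReal_le_ofReal (by linarith)
    _ = 0 + ε := by simp

end TestFunctions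

namespace StratifiedGroup

open StratifiedLieAlgebra Filter Topology

/-! ### Measurable hulls for the spherical measure. -/

section SphericalHull

variable {G : Type*} [NormedAddCommGroup G] [InnerProductSpace ℝ G] [FiniteDimensional ℝ G]
  [StratifiedGroup G] (d : HomogeneousDistance G)

theorem HomogeneousDistance.spherical_mono {α : ℝ} {A B : Set G} (h : A ⊆ B) :
    d.spherical α A ≤ d.spherical α B := by
  refine iSup₂_mono fun δ _ => ?_
  refine iInf_mono fun J => iInf_mono fun x => iInf_mono fun r => iInf_mono fun hr => ?_
  exact le_iInf fun hB => iInf_le _ (h.trans hB)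

/-- Intersect the unions of near-optimal covers at scales `1 / (n + 1)`: each such cover also covers
the intersection. This is needed because the pieces of a σ-finite set are not assumed measurable. -/
theorem HomogeneousDistance.exists_measurable_superset [MeasurableSpace G] [BorelSpace G] {α : ℝ}
    {A : Set G} (h : d.spherical α A < ⊤) :
    ∃ A', A ⊆ A' ∧ MeasurableSet A' ∧ d.spherical α A' < ⊤ := by
  have hlt : d.spherical α A < d.spherical α A + 1 := ENNReal.lt_add_right h.ne one_ne_zero
  have hcov : ∀ n : ℕ, ∃ U, A ⊆ U ∧ MeasurableSet U ∧
      d.sphericalPre α (1 / ((n : ℝ) + 1)) U ≤ d.spherical α A + 1 := by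
    intro n
    have h1 : d.sphericalPre α (1 / ((n : ℝ) + 1)) A < d.spherical α A + 1 :=
      lt_of_le_of_lt (le_iSup₂ (f := fun δ (_ : 0 < δ) => d.sphericalPre α δ A) _
        Nat.one_div_pos_of_nat) hlt
    simp only [sphericalPre, iInf_lt_iff] at h1
    obtain ⟨J, x, r, hr, hA, hsum⟩ := h1
    refine ⟨⋃ j ∈ J, d.ball (x j) (r j), hA,
      (isOpen_biUnion fun j _ => d.isOpen_ball _ _).measurableSet, le_trans ?_ hsum.le⟩
    exact iInf_le_of_le J <| iInf_le_of_le x <| iInf_le_of_le r <| iInf_le_of_le hr <|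
      iInf_le_of_le Set.Subset.rfl le_rfl
  choose U hAU hU hUpre using hcov
  refine ⟨⋂ n, U n, Set.subset_iInter hAU, MeasurableSet.iInter hU, ?_⟩
  have : d.spherical α (⋂ n, U n) ≤ d.spherical α A + 1 := by
    refine iSup₂_le fun δ hδ => ?_
    obtain ⟨n, hn⟩ := exists_nat_one_div_lt hδ
    refine le_trans ?_ (hUpre n)
    unfold sphericalPre
    refine iInf_mono fun J => iInf_mono fun x => iInf_mono fun r => ?_
    refine le_iInf fun hr => le_iInf fun hcov => ?_
    exact iInf_le_of_le (fun j hj => ⟨(hr j hj).1, (hr j hj).2.trans hn⟩) <|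
      iInf_le_of_le ((Set.iInter_subset U n).trans hcov) le_rfl
  exact this.trans_lt (ENNReal.add_lt_top.2 ⟨h, ENNReal.one_lt_top⟩)

end SphericalHull

section SignedRadon

variable {G : Type*} [NormedAddCommGroup G] [MeasurableSpace G] [BorelSpace G]

theorem SignedRadonMeasure.integrable_pos {Ω : Set G} (ν : SignedRadonMeasure Ω) {φ : G → ℝ}
    (hφ : Continuous φ) (hφc : HasCompactSupport φ) (h : tsupport φ ⊆ Ω) : Integrable φ ν.pos :=
  hφ.integrable_of_measure_tsupport_lt_top hφc (ν.pos_lt_top _ hφc h)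

theorem SignedRadonMeasure.integrable_neg {Ω : Set G} (ν : SignedRadonMeasure Ω) {φ : G → ℝ}
    (hφ : Continuous φ) (hφc : HasCompactSupport φ) (h : tsupport φ ⊆ Ω) : Integrable φ ν.neg :=
  hφ.integrable_of_measure_tsupport_lt_top hφc (ν.neg_lt_top _ hφc h)

end SignedRadon

/-! ### Null sets of the divergence. -/

section Divergence

variable {G : Type*} [NormedAddCommGroup G] [InnerProductSpace ℝ G] [FiniteDimensional ℝ G]
  [MeasurableSpace G] [BorelSpace G] [StratifiedGroup G]

variable {μ : Measure G} {F : G → layer (G := G) 1}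

omit [BorelSpace G] in
theorem setIntegral_inner_horizontalGradient {V Ω : Set G} (hΩ : MeasurableSet Ω) (hVΩ : V ⊆ Ω)
    {φ : G → ℝ} (hφ : ContDiff ℝ ∞ φ) (h : tsupport φ ⊆ V) :
    ∫ x in Ω, ⟪F x, horizontalGradient φ x⟫ ∂μ = ∫ x in V, ⟪F x, horizontalGradient φ x⟫ ∂μ := by
  refine setIntegral_eq_of_subset_of_forall_sdiff_eq_zero hΩ hVΩ fun x hx => ?_
  rw [horizontalGradient_eq_zero_of_notMem (hφ.differentiable (by simp)) fun hx' => hx.2 (h hx'),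
    inner_zero_right]

omit [BorelSpace G] in
theorem enorm_setIntegral_inner_horizontalGradient_le {V Ω : Set G} (hΩ : MeasurableSet Ω)
    (hVΩ : V ⊆ Ω) {φ : G → ℝ} (hφ : ContDiff ℝ ∞ φ) (h : tsupport φ ⊆ V) :
    ‖∫ x in Ω, ⟪F x, horizontalGradient φ x⟫ ∂μ‖ₑ ≤
      ∫⁻ x in V, ‖F x‖ₑ * ‖horizontalGradient φ x‖ₑ ∂μ := by
  rw [setIntegral_inner_horizontalGradient hΩ hVΩ hφ h]
  refine (enorm_integral_le_lintegral_enorm _).trans (lintegral_mono fun x => ?_)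
  simp only [enorm]
  exact_mod_cast nnnorm_inner_le_nnnorm (𝕜 := ℝ) (F x) (horizontalGradient φ x)

/-- Uniqueness of the divergence on the smaller set, written additively so that no difference of
possibly infinite values appears. -/
theorem IsDivergence.pos_add_neg_eq {Ω₁ Ω₂ : Set G} {ν₁ : SignedRadonMeasure Ω₁}
    {ν₂ : SignedRadonMeasure Ω₂} (h₁ : IsDivergence μ Ω₁ F ν₁) (h₂ : IsDivergence μ Ω₂ F ν₂)
    (hΩ₁ : IsOpen Ω₁) (hΩ₂ : IsOpen Ω₂) (hsub : Ω₁ ⊆ Ω₂) {T : Set G} (hT : MeasurableSet T)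
    (hTΩ : T ⊆ Ω₁) : ν₁.pos T + ν₂.neg T = ν₁.neg T + ν₂.pos T := by
  rw [← Measure.add_apply, ← Measure.add_apply]
  refine measure_eq_of_forall_testFunction hΩ₁ (fun K hK hKΩ => ?_) (fun K hK hKΩ => ?_)
    (fun φ hφ hφc hφΩ => ?_) hT hTΩ
  · exact ENNReal.add_lt_top.2 ⟨ν₁.pos_lt_top K hK hKΩ, ν₂.neg_lt_top K hK (hKΩ.trans hsub)⟩
  · exact ENNReal.add_lt_top.2 ⟨ν₁.neg_lt_top K hK hKΩ, ν₂.pos_lt_top K hK (hKΩ.trans hsub)⟩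
  · have e₁ := h₁ φ hφ hφc hφΩ
    have e₂ := h₂ φ hφ hφc (hφΩ.trans hsub)
    rw [setIntegral_inner_horizontalGradient hΩ₂.measurableSet hsub hφ hφΩ, e₁] at e₂
    rw [integral_add_measure (ν₁.integrable_pos hφ.continuous hφc hφΩ)
        (ν₂.integrable_neg hφ.continuous hφc (hφΩ.trans hsub)),
      integral_add_measure (ν₁.integrable_neg hφ.continuous hφc hφΩ)
        (ν₂.integrable_pos hφ.continuous hφc (hφΩ.trans hsub))]
    linarith

theorem IsDivergence.variation_eq_zero {Ω : Set G} {ν : SignedRadonMeasure Ω}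
    (hν : IsDivergence μ Ω F ν) (hΩ : IsOpen Ω) {B : Set G} (hB : MeasurableSet B) (hBΩ : B ⊆ Ω)
    (h : ∀ K, IsCompact K → K ⊆ B → ∀ U, IsOpen U → K ⊆ U → U ⊆ Ω → ∀ ε : ℝ, 0 < ε →
      ∃ φ : G → ℝ, ContDiff ℝ ∞ φ ∧ HasCompactSupport φ ∧ tsupport φ ⊆ U ∧
        (∀ x, 0 ≤ φ x ∧ φ x ≤ 1) ∧ (∀ x ∈ K, φ x = 1) ∧
        |∫ x in Ω, ⟪F x, horizontalGradient φ x⟫ ∂μ| ≤ ε) :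
    ν.variation B = 0 := by
  -- The positive part lives off `S` and the negative part on `S`. On each of `B \ S` and `B ∩ S`
  -- one part vanishes and the cutoffs annihilate the other.
  obtain ⟨S, hS, hposS, hnegS⟩ := ν.mutuallySingular
  have hzero : ∀ {α : Measure G}, (∀ K, IsCompact K → K ⊆ Ω → α K < ⊤) → ∀ {T : Set G},
      MeasurableSet T → T ⊆ B → (∀ K, IsCompact K → K ⊆ T → α K = 0) → α T = 0 := by
    intro α hα T hT hTB hK
    refine le_antisymm ?_ bot_le
    exact hT.measure_le_of_forall_isCompact hΩ (β := 0) hα (hTB.trans hBΩ)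
      fun K hKc hKT => (hK K hKc hKT).le
  have hpos : ν.pos (B \ S) = 0 := by
    refine hzero ν.pos_lt_top (hB.diff hS) Set.sdiff_subset fun K hK hKT => ?_
    have hKB : K ⊆ B := hKT.trans Set.sdiff_subset
    refine hK.measure_eq_zero_of_small_cutoffs hΩ ν.pos_lt_top ν.neg_lt_top (hKB.trans hBΩ)
      (measure_mono_null (fun x hx => (hKT hx).2) hnegS) fun U hU hKU hUΩ ε hε => ?_
    obtain ⟨φ, hφ, hφc, hφU, h01, h1, hint⟩ := h K hK hKB U hU hKU hUΩ ε hε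
    refine ⟨φ, hφ, hφc, hφU, h01, h1, ?_⟩
    rw [← hν φ hφ hφc (hφU.trans hUΩ)]
    exact (neg_le_abs _).trans hint
  have hneg : ν.neg (B ∩ S) = 0 := by
    refine hzero ν.neg_lt_top (hB.inter hS) Set.inter_subset_left fun K hK hKT => ?_
    have hKB : K ⊆ B := hKT.trans Set.inter_subset_left
    refine hK.measure_eq_zero_of_small_cutoffs hΩ ν.neg_lt_top ν.pos_lt_top (hKB.trans hBΩ)
      (measure_mono_null (fun x hx => (hKT hx).2) hposS) fun U hU hKU hUΩ ε hε => ?_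
    obtain ⟨φ, hφ, hφc, hφU, h01, h1, hint⟩ := h K hK hKB U hU hKU hUΩ ε hε
    refine ⟨φ, hφ, hφc, hφU, h01, h1, ?_⟩
    have := hν φ hφ hφc (hφU.trans hUΩ)
    linarith [le_abs_self (∫ x in Ω, ⟪F x, horizontalGradient φ x⟫ ∂μ)]
  rw [SignedRadonMeasure.variation, Measure.add_apply, add_eq_zero]
  constructor
  · rw [← Set.inter_union_sdiff B S]
    exact measure_union_null (measure_mono_null Set.inter_subset_right hposS) hpos
  · rw [← Set.inter_union_sdiff B S]
    exact measure_union_null hneg (measure_mono_null (fun x hx => hx.2) hnegS)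

theorem IsDMLoc.exists_cutoff_top [μ.IsHaarMeasure] (d : HomogeneousDistance G) {Ω : Set G}
    (hF : IsDMLoc μ ⊤ Ω F) (hΩ : IsOpen Ω) {K : Set G} (hK : IsCompact K)
    (hKS : d.spherical (homDim G - 1) K = 0) {U : Set G} (hU : IsOpen U) (hKU : K ⊆ U)
    (hUΩ : U ⊆ Ω) {ε : ℝ} (hε : 0 < ε) :
    ∃ φ : G → ℝ, ContDiff ℝ ∞ φ ∧ HasCompactSupport φ ∧ tsupport φ ⊆ U ∧
      (∀ x, 0 ≤ φ x ∧ φ x ≤ 1) ∧ (∀ x ∈ K, φ x = 1) ∧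
      |∫ x in Ω, ⟪F x, horizontalGradient φ x⟫ ∂μ| ≤ ε := by
  obtain ⟨V, hV, hKV, hVU, hVc⟩ := exists_open_between_and_isCompact_closure hK hU hKU
  have hFV := (hF V hV hVc (hVU.trans hUΩ)).1
  set A := eLpNormEssSup F (μ.restrict V) with hA
  have hAtop : A ≠ ⊤ := by simpa [eLpNorm_exponent_top] using hFV.2.ne
  obtain ⟨C, hC, hcut⟩ := d.exists_testFunction μ le_rfl
  have hACtop : A * C ≠ ⊤ := ENNReal.mul_ne_top hAtop hC
  -- The final bound is `A C` times this quantity; the `+ 1` avoids division by zero.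
  have hM : d.spherical (homDim G - 1) K < ENNReal.ofReal ε / (A * C + 1) := by
    rw [hKS]
    exact ENNReal.div_pos (ENNReal.ofReal_pos.2 hε).ne' (by simp [hACtop])
  obtain ⟨φ, hφ, hφc, hφV, h01, h1, hint⟩ := hcut K V _ hK hV hKV hVc hM
  refine ⟨φ, hφ, hφc, hφV.trans (subset_closure.trans hVU), h01, h1, ?_⟩
  rw [← ENNReal.ofReal_le_ofReal_iff hε.le, ← Real.enorm_eq_ofReal_abs]
  calc ‖∫ x in Ω, ⟪F x, horizontalGradient φ x⟫ ∂μ‖ₑ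
      ≤ ∫⁻ x in V, ‖F x‖ₑ * ‖horizontalGradient φ x‖ₑ ∂μ :=
        enorm_setIntegral_inner_horizontalGradient_le hΩ.measurableSet
          (subset_closure.trans (hVU.trans hUΩ)) hφ hφV
    _ ≤ ∫⁻ x in V, A * ‖horizontalGradient φ x‖ₑ ∂μ := by
        refine lintegral_mono_ae ?_
        filter_upwards [enorm_ae_le_eLpNormEssSup F (μ.restrict V)] with x hx
        gcongr
    _ ≤ A * ∫⁻ x, ENNReal.ofReal (‖horizontalGradient φ x‖ ^ (1 : ℝ)) ∂μ := by
        rw [lintegral_const_mul' _ _ hAtop]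
        simp only [Real.rpow_one, ofReal_norm]
        gcongr
        exact Measure.restrict_le_self
    _ ≤ A * C * (ENNReal.ofReal ε / (A * C + 1)) := by
        rw [mul_assoc]
        gcongr
    _ ≤ ENNReal.ofReal ε := by
        calc _ ≤ (A * C + 1) * (ENNReal.ofReal ε / (A * C + 1)) := by
              gcongr
              exact le_self_add
          _ = ENNReal.ofReal ε := ENNReal.mul_div_cancel (by simp) (by simp [hACtop])

theorem IsDMLoc.exists_cutoff [μ.IsHaarMeasure] (d : HomogeneousDistance G) {Ω : Set G} {p : ℝ}
    (hp : 1 < p) (hF : IsDMLoc μ (ENNReal.ofReal p) Ω F) (hΩ : IsOpen Ω) {K : Set G}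
    (hK : IsCompact K) (hKS : d.spherical (homDim G - p / (p - 1)) K < ⊤) {U : Set G}
    (hU : IsOpen U) (hKU : K ⊆ U) (hUΩ : U ⊆ Ω) {ε : ℝ} (hε : 0 < ε) :
    ∃ φ : G → ℝ, ContDiff ℝ ∞ φ ∧ HasCompactSupport φ ∧ tsupport φ ⊆ U ∧
      (∀ x, 0 ≤ φ x ∧ φ x ≤ 1) ∧ (∀ x ∈ K, φ x = 1) ∧
      |∫ x in Ω, ⟪F x, horizontalGradient φ x⟫ ∂μ| ≤ ε := by
  have hpq : p.HolderConjugate (p / (p - 1)) := Real.HolderConjugate.conjExponent hp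
  set q := p / (p - 1) with hq
  have hp0 : 0 < p := hpq.pos
  have hq0 : 0 < q := hpq.symm.pos
  have hq1 : 1 ≤ q := hpq.symm.lt.le
  obtain ⟨C, hC, hcut⟩ := d.exists_testFunction μ hq1
  set M := d.spherical (homDim G - q) K + 1 with hMdef
  have hM : d.spherical (homDim G - q) K < M := ENNReal.lt_add_right hKS.ne one_ne_zero
  have hMtop : M ≠ ⊤ := by simp [M, hKS.ne]
  set c := (C * M) ^ (1 / q) with hc
  have hctop : c ≠ ⊤ :=
    ENNReal.rpow_ne_top_of_nonneg (one_div_pos.2 hq0).le (ENNReal.mul_ne_top hC hMtop)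
  have hμK : μ K = 0 := d.measure_eq_zero_of_spherical_lt_top μ hq0 hK hKS
  obtain ⟨V, hV, hKV, hVU, hVc⟩ := exists_open_between_and_isCompact_closure hK hU hKU
  have hFV := (hF V hV hVc (hVU.trans hUΩ)).1
  -- The smallness comes from here: `κ` is finite and vanishes on the `μ`-null set `K`, so it is
  -- small on some neighbourhood `V'`, while the capacity bound `c` does not depend on `V'`.
  let κ := (μ.restrict V).withDensity fun x => ‖F x‖ₑ ^ p
  have hκ : ∀ L, IsCompact L → L ⊆ V → κ L < ⊤ := by
    intro L _ _
    refine (measure_mono (Set.subset_univ L)).trans_lt ?_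
    rw [withDensity_apply _ MeasurableSet.univ, Measure.restrict_univ]
    have := lintegral_rpow_enorm_lt_top_of_eLpNorm_lt_top (by simp [hp0]) ENNReal.ofReal_ne_top
      hFV.2
    rwa [ENNReal.toReal_ofReal hp0.le] at this
  have hκK : κ K = 0 := withDensity_absolutelyContinuous _ _
    (le_antisymm ((Measure.restrict_apply_le _ _).trans_eq hμK) bot_le)
  have hη : 0 < (ENNReal.ofReal ε / (c + 1)) ^ p := ENNReal.rpow_pos
    (ENNReal.div_pos (ENNReal.ofReal_pos.2 hε).ne' (by simp [hctop]))
    (ENNReal.div_ne_top ENNReal.ofReal_ne_top (by simp))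
  obtain ⟨V', hV', hKV', hVV', hκV'⟩ := hK.exists_isOpen_measure_lt hV hκ hKV (hκK.trans_lt hη)
  obtain ⟨φ, hφ, hφc, hφV, h01, h1, hint⟩ := hcut K V' M hK hV' hKV'
    (hVc.of_isClosed_subset isClosed_closure (closure_mono hVV')) hM
  have hV'U : V' ⊆ U := hVV'.trans (subset_closure.trans hVU)
  refine ⟨φ, hφ, hφc, hφV.trans hV'U, h01, h1, ?_⟩
  rw [← ENNReal.ofReal_le_ofReal_iff hε.le, ← Real.enorm_eq_ofReal_abs]
  have hFm : AEMeasurable (fun x => ‖F x‖ₑ) (μ.restrict V') :=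
    (hFV.1.mono_measure (Measure.restrict_mono hVV' le_rfl)).enorm
  have hGm : AEMeasurable (fun x => ‖horizontalGradient φ x‖ₑ) (μ.restrict V') :=
    (continuous_horizontalGradient hφ).aestronglyMeasurable.enorm
  have hF' : (∫⁻ x in V', ‖F x‖ₑ ^ p ∂μ) ^ (1 / p) ≤ ENNReal.ofReal ε / (c + 1) := by
    rw [one_div, ENNReal.rpow_inv_le_iff hp0]
    refine le_trans (le_of_eq ?_) hκV'.le
    rw [withDensity_apply _ hV'.measurableSet, Measure.restrict_restrict hV'.measurableSet,
      Set.inter_eq_left.2 hVV']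
  have hG' : (∫⁻ x in V', ‖horizontalGradient φ x‖ₑ ^ q ∂μ) ^ (1 / q) ≤ c := by
    refine ENNReal.rpow_le_rpow (le_trans ?_ hint) (one_div_pos.2 hq0).le
    refine (setLIntegral_le_lintegral _ _).trans_eq (lintegral_congr fun x => ?_)
    rw [← ENNReal.ofReal_rpow_of_nonneg (norm_nonneg _) hq0.le, ofReal_norm]
  calc ‖∫ x in Ω, ⟪F x, horizontalGradient φ x⟫ ∂μ‖ₑ
      ≤ ∫⁻ x in V', ‖F x‖ₑ * ‖horizontalGradient φ x‖ₑ ∂μ :=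
        enorm_setIntegral_inner_horizontalGradient_le hΩ.measurableSet (hV'U.trans hUΩ) hφ hφV
    _ ≤ (∫⁻ x in V', ‖F x‖ₑ ^ p ∂μ) ^ (1 / p) *
          (∫⁻ x in V', ‖horizontalGradient φ x‖ₑ ^ q ∂μ) ^ (1 / q) :=
        ENNReal.lintegral_mul_le_Lp_mul_Lq _ hpq hFm hGm
    _ ≤ ENNReal.ofReal ε / (c + 1) * (c + 1) := by
        gcongr
        exact hG'.trans le_self_add
    _ = ENNReal.ofReal ε := ENNReal.div_mul_cancel (by simp) (by simp [hctop])

end Divergence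

/-! ### Gluing local divergences. -/

section Gluing

variable {G : Type*} [NormedAddCommGroup G] [InnerProductSpace ℝ G] [FiniteDimensional ℝ G]
  [MeasurableSpace G] [BorelSpace G] [StratifiedGroup G]
  {μ : Measure G} {F : G → layer (G := G) 1}

/-- A field with locally summable coefficients and local Radon divergence has a Radon
divergence. -/
theorem IsDMLoc.exists_isDivergence {p : ℝ≥0∞} {Ω : Set G} (hF : IsDMLoc μ p Ω F)
    (hΩ : IsOpen Ω) : ∃ ν : SignedRadonMeasure Ω, IsDivergence μ Ω F ν := by
  obtain ⟨W, hW, hWc, hWs, hWu⟩ := hΩ.exists_exhaustion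
  have hWm : Monotone W := monotone_nat_of_le_succ fun n => subset_closure.trans (hWs n)
  have hWΩ : ∀ n, W n ⊆ Ω := fun n => hWu ▸ Set.subset_iUnion W n
  -- The shift by one matters: the shell `D n ⊆ W n` has compact closure in `W (n + 1)`, so `ν n` is
  -- finite on it.
  have hex : ∀ n, ∃ ν : SignedRadonMeasure (W (n + 1)), IsDivergence μ (W (n + 1)) F ν := fun n =>
    (hF (W (n + 1)) (hW _) (hWc _) ((hWs _).trans (hWΩ _))).2
  choose ν hν using hex
  set D := disjointed W with hD
  have hDm : ∀ n, MeasurableSet (D n) := fun n =>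
    MeasurableSet.disjointed (fun n => (hW n).measurableSet) n
  have hDW : ∀ n, D n ⊆ W n := disjointed_subset W
  have hDdisj : Pairwise (Function.onFun Disjoint D) := disjoint_disjointed W
  have hDu : ⋃ n, D n = Ω := (iUnion_disjointed).trans hWu
  have hDlt : ∀ {N n}, N < n → ∀ s ⊆ W N, s ∩ D n = ∅ := by
    intro N n hNn s hs
    refine Set.eq_empty_of_forall_notMem fun x hx => ?_
    have h2 := hx.2
    rw [hD, disjointed_eq_inter_compl] at h2
    exact Set.mem_iInter₂.1 h2.2 N hNn (hs hx.1)
  have hcl : ∀ {K : Set G} (n : ℕ), IsCompact K → ∃ L, IsCompact L ∧ L ⊆ W (n + 1) ∧ K ∩ D n ⊆ L :=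
    fun {K} n hK => ⟨K ∩ closure (W n), hK.inter_right isClosed_closure,
      Set.inter_subset_right.trans (hWs n),
      Set.inter_subset_inter_right K ((hDW n).trans subset_closure)⟩
  have hfin : ∀ α : ℕ → Measure G, (∀ n K, IsCompact K → K ⊆ W (n + 1) → α n K < ⊤) →
      ∀ K, IsCompact K → K ⊆ Ω → Measure.sum (fun n => (α n).restrict (D n)) K < ⊤ := by
    intro α hα K hK hKΩ
    obtain ⟨N, hN⟩ := hK.exists_subset_of_exhaustion hW hWm (hKΩ.trans hWu.ge)
    rw [Measure.sum_apply _ hK.measurableSet,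
      tsum_eq_sum (s := Finset.range (N + 1)) fun n hn => ?_]
    · refine ENNReal.sum_lt_top.2 fun n _ => ?_
      rw [Measure.restrict_apply hK.measurableSet]
      obtain ⟨L, hL, hLW, hKL⟩ := hcl n hK
      exact (measure_mono hKL).trans_lt (hα n L hL hLW)
    · rw [Measure.restrict_apply hK.measurableSet,
        hDlt (Nat.lt_of_succ_le (not_lt.1 fun h => hn (Finset.mem_range.2 h))) K hN, measure_empty]
  have hcompl : ∀ α : ℕ → Measure G, Measure.sum (fun n => (α n).restrict (D n)) Ωᶜ = 0 := by
    intro α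
    rw [Measure.sum_apply _ hΩ.measurableSet.compl, ENNReal.tsum_eq_zero]
    intro n
    rw [Measure.restrict_apply hΩ.measurableSet.compl]
    have : Ωᶜ ∩ D n = ∅ := Set.eq_empty_of_forall_notMem fun x hx =>
      hx.1 (hWΩ n (hDW n hx.2))
    rw [this, measure_empty]
  -- Each shell carries its own local divergence. Mutual singularity holds within a shell by
  -- hypothesis and across shells by disjointness.
  let ν' : SignedRadonMeasure Ω :=
    { pos := Measure.sum fun n => (ν n).pos.restrict (D n)
      neg := Measure.sum fun n => (ν n).neg.restrict (D n)
      mutuallySingular := by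
        refine Measure.MutuallySingular.sum_left.2 fun i =>
          Measure.MutuallySingular.sum_right.2 fun j => ?_
        rcases eq_or_ne i j with rfl | hij
        · exact (ν i).mutuallySingular.mono Measure.restrict_le_self Measure.restrict_le_self
        · refine ⟨(D i)ᶜ, (hDm i).compl, ?_, ?_⟩
          · rw [Measure.restrict_apply (hDm i).compl, Set.compl_inter_self, measure_empty]
          · rw [compl_compl, Measure.restrict_apply (hDm i), (hDdisj hij).inter_eq, measure_empty]
      pos_compl := hcompl _
      neg_compl := hcompl _
      pos_lt_top := hfin _ fun n => (ν n).pos_lt_top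
      neg_lt_top := hfin _ fun n => (ν n).neg_lt_top }
  have hlocal : ∀ N s, MeasurableSet s → s ⊆ W N →
      ν'.pos s + (ν N).neg s = ν'.neg s + (ν N).pos s := by
    intro N s hs hsN
    have hdec : ∀ α : Measure G, α s = ∑' n, α (s ∩ D n) := by
      intro α
      have : s = ⋃ n, s ∩ D n := by
        rw [← Set.inter_iUnion, hDu, Set.inter_eq_left.2 (hsN.trans (hWΩ N))]
      conv_lhs => rw [this]
      exact measure_iUnion (fun i j hij => (hDdisj hij).mono Set.inter_subset_right
        Set.inter_subset_right) fun n => hs.inter (hDm n)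
    have hsum : ∀ α : ℕ → Measure G, Measure.sum (fun n => (α n).restrict (D n)) s =
        ∑' n, α n (s ∩ D n) := by
      intro α
      rw [Measure.sum_apply _ hs]
      exact tsum_congr fun n => Measure.restrict_apply hs
    change Measure.sum (fun n => (ν n).pos.restrict (D n)) s + _ =
      Measure.sum (fun n => (ν n).neg.restrict (D n)) s + _
    rw [hsum, hsum, hdec (ν N).neg, hdec (ν N).pos, ← ENNReal.tsum_add, ← ENNReal.tsum_add]
    refine tsum_congr fun n => ?_
    -- Shells with `n ≤ N` are compared through uniqueness on `W (n + 1) ⊆ W (N + 1)`; later shells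
    -- do not meet `W N`.
    rcases le_or_gt n N with hn | hn
    · exact (hν n).pos_add_neg_eq (hν N) (hW _) (hW _) (hWm (Nat.add_le_add_right hn 1))
        (hs.inter (hDm n)) (Set.inter_subset_right.trans ((hDW n).trans (hWm n.le_succ)))
    · simp [hDlt hn s hsN]
  refine ⟨ν', fun φ hφ hφc hφΩ => ?_⟩
  obtain ⟨N, hN⟩ := hφc.isCompact.exists_subset_of_exhaustion hW hWm (hφΩ.trans hWu.ge)
  have hN1 : tsupport φ ⊆ W (N + 1) := hN.trans (hWm N.le_succ)
  rw [setIntegral_inner_horizontalGradient hΩ.measurableSet (hWΩ (N + 1)) hφ hN1,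
    hν N φ hφ hφc hN1]
  have hrestrict : (ν'.pos + (ν N).neg).restrict (W N) = (ν'.neg + (ν N).pos).restrict (W N) := by
    ext s hs
    rw [Measure.restrict_apply hs, Measure.restrict_apply hs, Measure.add_apply,
      Measure.add_apply]
    exact hlocal N _ (hs.inter (hW N).measurableSet) Set.inter_subset_right
  have hzero : ∀ x, x ∉ W N → φ x = 0 := fun x hx =>
    image_eq_zero_of_notMem_tsupport fun hx' => hx (hN hx')
  have hint : ∫ x, φ x ∂(ν'.pos + (ν N).neg) = ∫ x, φ x ∂(ν'.neg + (ν N).pos) := by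
    rw [← setIntegral_eq_integral_of_forall_compl_eq_zero hzero, hrestrict,
      setIntegral_eq_integral_of_forall_compl_eq_zero hzero]
  rw [integral_add_measure (ν'.integrable_pos hφ.continuous hφc hφΩ)
      ((ν N).integrable_neg hφ.continuous hφc hN1),
    integral_add_measure (ν'.integrable_neg hφ.continuous hφc hφΩ)
      ((ν N).integrable_pos hφ.continuous hφc hN1)] at hint
  linarith

end Gluing

end StratifiedGroup

/-! ### The main theorem. -/

theorem mainTheorem9 {G : Type*} [NormedAddCommGroup G] [InnerProductSpace ℝ G]
    [FiniteDimensional ℝ G] [MeasurableSpace G] [BorelSpace G] [StratifiedGroup G]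
    (μ : Measure G) [μ.IsHaarMeasure] (d : StratifiedGroup.HomogeneousDistance G)
    (Q : ℝ) (hQ : Q = (StratifiedLieAlgebra.homDim G : ℝ))
    (Ω : Set G) (hΩ : IsOpen Ω)
    (F : G → StratifiedLieAlgebra.layer (G := G) 1) :
    (∀ p : ℝ, 1 < Q → Q / (Q - 1) ≤ p →
      StratifiedGroup.IsDMLoc μ (ENNReal.ofReal p) Ω F →
        (∃ ν : StratifiedGroup.SignedRadonMeasure Ω, StratifiedGroup.IsDivergence μ Ω F ν) ∧
        ∀ ν : StratifiedGroup.SignedRadonMeasure Ω, StratifiedGroup.IsDivergence μ Ω F ν →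
          ∀ B : Set G, MeasurableSet B → B ⊆ Ω →
            d.IsSphericalSigmaFinite (Q - p / (p - 1)) B → ν.variation B = 0) ∧
    (StratifiedGroup.IsDMLoc μ ⊤ Ω F →
        (∃ ν : StratifiedGroup.SignedRadonMeasure Ω, StratifiedGroup.IsDivergence μ Ω F ν) ∧
        ∀ ν : StratifiedGroup.SignedRadonMeasure Ω, StratifiedGroup.IsDivergence μ Ω F ν →
          ∀ B : Set G, MeasurableSet B → B ⊆ Ω →
            d.spherical (Q - 1) B = 0 → ν.variation B = 0) := by
  subst hQ
  refine ⟨fun p hQ1 hp hF => ⟨hF.exists_isDivergence hΩ, fun ν hν B hB hBΩ hfin => ?_⟩,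
    fun hF => ⟨hF.exists_isDivergence hΩ, fun ν hν B hB hBΩ hzero => ?_⟩⟩
  · have hp1 : 1 < p := by
      refine lt_of_lt_of_le ?_ hp
      rw [one_lt_div (by linarith)]
      linarith
    obtain ⟨A, rfl, hA⟩ := hfin
    choose A' hAA' hA'm hA' using fun n => d.exists_measurable_superset (hA n)
    -- Intersecting the Borel hulls with `B` gives Borel pieces that stay inside `Ω` and have finite
    -- spherical measure.
    have hcover : ⋃ n, A n ⊆ ⋃ n, (⋃ k, A k) ∩ A' n := by
      rw [← Set.inter_iUnion]
      exact Set.subset_inter Set.Subset.rfl (Set.iUnion_mono hAA')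
    refine measure_mono_null hcover (measure_iUnion_null fun n => ?_)
    refine hν.variation_eq_zero hΩ (hB.inter (hA'm n)) (Set.inter_subset_left.trans hBΩ)
      fun K hK hKB U hU hKU hUΩ ε hε => ?_
    exact hF.exists_cutoff d hp1 hΩ hK
      ((d.spherical_mono (hKB.trans Set.inter_subset_right)).trans_lt (hA' n)) hU hKU hUΩ hε
  · refine hν.variation_eq_zero hΩ hB hBΩ fun K hK hKB U hU hKU hUΩ ε hε => ?_
    exact hF.exists_cutoff_top d hΩ hK
      (le_antisymm ((d.spherical_mono hKB).trans hzero.le) bot_le) hU hKU hUΩ hε
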